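/- Let $C$ be a finite set of candidates. A (complete) vote is a linear order on $C$; a partial vote is a partial order on $C$; an unordered pair of distinct candidates is undetermined in a partial vote if the two candidates are incomparable in it. For a profile $V=(\succ_1,\dots,\succ_n)$ of complete votes and candidates $x\neq y$, put $D_V(x,y)=|\{i: x\succ_i y\}|-|\{i: y\succ_i x\}|$. The maximin score of $x$ is $\min_{y\neq x}D_V(x,y)$, and the maximin co-winners of $V$ are the candidates of maximum maximin score. The Possible Winner problem for maximin asks, given $C$, a profile $P=(p_1,\dots,p_n)$ of partial votes over $C$ and a candidate $c\in C$, whether each $p_i$ can be extended to a complete vote such that $c$ is a maximin co-winner of the resulting profile. Theorem. The Possible Winner problem for the maximin voting rule, restricted to instances in which every partial vote has at most $1$ undetermined pair of candidates, is in $\mathsf{P}$. That is, the language of the binary encodings of all such instances with answer "yes" is decided by a deterministic Turing machine in time polynomial in the length of its input. (An instance is encoded by the numbers of candidates and of voters and the index of $c$, all in unary, followed by the $|C|\times|C|$ Boolean matrix of each partial vote.) -/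

import Mathlib

/-- A partial vote over the candidates `C`: a partial order. `pref x y` reads
`x` is weakly preferred to `y`. -/
@[ext]
structure PartialVote (C : Type) where
  pref : C → C → Bool
  refl : ∀ x, pref x x = true
  antisymm : ∀ x y, pref x y = true → pref y x = true → x = y
  trans : ∀ x y z, pref x y = true → pref y z = true → pref x z = true

/-- A (complete) vote over the candidates `C`: a linear order. -/
structure CompleteVote (C : Type) extends PartialVote C where
  total : ∀ x y, pref x y = true ∨ pref y x = true

namespace CompleteVote

/-- `x` is placed before `y` in the vote `v`. -/
def Before {C : Type} (v : CompleteVote C) (x y : C) : Prop :=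
  v.pref x y = true ∧ x ≠ y

instance {C : Type} [DecidableEq C] (v : CompleteVote C) (x y : C) : Decidable (v.Before x y) :=
  inferInstanceAs (Decidable (_ ∧ _))

/-- The complete vote `v` extends the partial vote `p`. -/
def Extends {C : Type} (v : CompleteVote C) (p : PartialVote C) : Prop :=
  ∀ x y, p.pref x y = true → v.pref x y = true

end CompleteVote

/-- The undetermined pairs of a partial vote: the two-element sets of candidates
whose ordering is not fixed by the vote. -/
def PartialVote.undeterminedPairs {C : Type} [Fintype C] [DecidableEq C] (p : PartialVote C) :
    Finset (Finset C) :=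
  (Finset.univ.powersetCard 2).filter fun s => ∀ x ∈ s, ∀ y ∈ s, x ≠ y → p.pref x y = false

section Maximin

/-- The margin of `x` from `y`: the number of voters who place `x` before `y` minus the number
of voters who place `y` before `x`. -/
def margin {C : Type} [DecidableEq C] {n : ℕ} (V : Fin n → CompleteVote C) (x y : C) : ℤ :=
  ((Finset.univ.filter fun i => (V i).Before x y).card : ℤ)
    - ((Finset.univ.filter fun i => (V i).Before y x).card : ℤ)

/-- The maximin score of `x`: the minimum over all `y ≠ x` of the margin of `x` from `y`
(`⊤` if `x` is the only candidate). -/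
def maximinScore {C : Type} [Fintype C] [DecidableEq C] {n : ℕ} (V : Fin n → CompleteVote C)
    (x : C) : WithTop ℤ :=
  (Finset.univ.erase x).inf fun y => (margin V x y : WithTop ℤ)

/-- The (co-)winners under the maximin rule: the candidates of maximum maximin score. -/
def maximinWinners {C : Type} [Fintype C] [DecidableEq C] {n : ℕ} (V : Fin n → CompleteVote C) :
    Set C :=
  {x | ∀ y, maximinScore V y ≤ maximinScore V x}

end Maximin

/-- An instance `(C, P, c)` of the possible winner problem: `C = Fin numCandidates`, a profile `P`
of partial votes over `C`, one for each voter, and a distinguished candidate `c`. -/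
structure PossibleWinnerInstance where
  numCandidates : ℕ
  numVoters : ℕ
  candidate : Fin numCandidates
  votes : Fin numVoters → PartialVote (Fin numCandidates)

namespace PossibleWinnerInstance

/-- Some extension of the partial votes to complete votes makes the distinguished candidate a
co-winner under the maximin rule. -/
def IsMaximinYes (I : PossibleWinnerInstance) : Prop :=
  ∃ V : Fin I.numVoters → CompleteVote (Fin I.numCandidates),
    (∀ i, (V i).Extends (I.votes i)) ∧ I.candidate ∈ maximinWinners V

/-- Every partial vote has at most `t` undetermined pairs of candidates. -/
def UndeterminedAtMost (I : PossibleWinnerInstance) (t : ℕ) : Prop :=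
  ∀ i, (I.votes i).undeterminedPairs.card ≤ t

end PossibleWinnerInstance

/-- The bit string `1ᵏ0`. -/
def unaryBits (k : ℕ) : List Bool :=
  List.replicate k true ++ [false]

/-- The `m × m` Boolean matrix of a partial vote, row by row. -/
def PartialVote.bits {m : ℕ} (p : PartialVote (Fin m)) : List Bool :=
  (List.ofFn fun x => List.ofFn fun y => p.pref x y).flatten

/-- The encoding of an instance as a bit string: number of candidates, number of voters and index
of the distinguished candidate in unary, followed by the matrices of all partial votes. -/
def PossibleWinnerInstance.encode (I : PossibleWinnerInstance) : List Bool :=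
  unaryBits I.numCandidates ++ unaryBits I.numVoters ++ unaryBits I.candidate
    ++ (List.ofFn fun i => (I.votes i).bits).flatten

theorem unaryBits_append_inj {k l : ℕ} {s t : List Bool}
    (h : unaryBits k ++ s = unaryBits l ++ t) : k = l ∧ s = t := by
  induction k generalizing l with
  | zero => cases l <;> simp_all [unaryBits, List.replicate_succ]
  | succ k ih =>
    cases l with
    | zero => simp_all [unaryBits, List.replicate_succ]
    | succ l =>
      have := @ih l (by simpa [unaryBits, List.replicate_succ] using h)
      exact ⟨by omega, this.2⟩

theorem flatten_ofFn_inj {n m : ℕ} {f g : Fin n → List Bool} (hf : ∀ i, (f i).length = m)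
    (hg : ∀ i, (g i).length = m) (h : (List.ofFn f).flatten = (List.ofFn g).flatten) : f = g := by
  induction n with
  | zero => exact Subsingleton.elim _ _
  | succ n ih =>
    simp only [List.ofFn_succ, List.flatten_cons] at h
    obtain ⟨h0, h1⟩ := List.append_inj h ((hf 0).trans (hg 0).symm)
    have h2 := ih (fun i => hf i.succ) (fun i => hg i.succ) h1
    funext i
    exact Fin.cases h0 (fun j => congrFun h2 j) i

theorem PartialVote.length_bits {m : ℕ} (p : PartialVote (Fin m)) : p.bits.length = m * m := by
  simp [PartialVote.bits, List.length_flatten, Function.comp_def]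

theorem PartialVote.bits_injective {m : ℕ} :
    Function.Injective (PartialVote.bits : PartialVote (Fin m) → List Bool) := by
  intro p q h
  have h1 := flatten_ofFn_inj (m := m) (by simp) (by simp) h
  ext x y
  have := List.ofFn_injective (congrFun h1 x)
  rw [congrFun this y]

/-- Different instances have different encodings. -/
theorem PossibleWinnerInstance.encode_injective :
    Function.Injective PossibleWinnerInstance.encode := by
  rintro ⟨m, n, c, P⟩ ⟨m', n', c', P'⟩ h
  simp only [PossibleWinnerInstance.encode, List.append_assoc] at h
  obtain ⟨rfl, h⟩ := unaryBits_append_inj h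
  obtain ⟨rfl, h⟩ := unaryBits_append_inj h
  obtain ⟨hc, h⟩ := unaryBits_append_inj h
  obtain rfl := Fin.ext hc
  have h1 := flatten_ofFn_inj (fun i => (P i).length_bits) (fun i => (P' i).length_bits)
    (List.append_cancel_left h)
  congr 1
  funext i
  exact PartialVote.bits_injective (congrFun h1 i)

/-- The maximin possible winner problem (co-winner version), restricted to instances in which every
partial vote has at most `t` undetermined pairs of candidates, as a language over `{0, 1}`. -/
def maximinPossibleWinner (t : ℕ) : Language Bool :=
  {w | ∃ I : PossibleWinnerInstance, I.encode = w ∧ I.UndeterminedAtMost t ∧ I.IsMaximinYes}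

/-- The complexity class P: a language over `{0, 1}` is in P if its characteristic function is
computed by a multi-stack Turing machine in time bounded by a polynomial in the input length. -/
def InP (L : Language Bool) : Prop :=
  ∃ f : List Bool → Bool, (∀ w, f w = true ↔ w ∈ L) ∧
    Nonempty (Turing.TM2ComputableInPolyTime (id : List Bool → List Bool)
      Computability.encodeBool f)

/-! Combinatorial part. Every open pair involving `c` may be settled in favour of `c`: this raises
the score of `c` to the minimum of `highMargin P c z` over `z ≠ c` and lowers the margins of the
others from `c`. It remains to give every `x ≠ c` a rival `f x` from which its margin does not
exceed that score. Since a vote has at most one open pair, distinct pairs can be settled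
independently (`exists_extension_wonCount`), so two choices interact only when `x` and `y` choose
each other; then a single margin must be small enough for both, which is `CanTie`. This is
`maximin_possible_iff`.

A candidate is `Secure` if it has a rival that causes no such clash. For every other candidate all
possible rivals are neighbours in `conflictGraph`, and the two ends of an edge must not choose each
other. Each non-secure vertex thus claims an incident edge of its own, which is possible exactly
when every component has a secure vertex or a cycle (`SimpleGraph.exists_choice_iff`): walk towards
the secure vertex, or go around the cycle and walk towards it from elsewhere; conversely, following
choices without backtracking in a finite graph closes a cycle. Breadth first search decides this, a
cycle through an edge being detected by reachability after its deletion.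

Computational part. Structured programs on registers of bits compile to stack machines with one
machine step per program step (`Exec.iterate`). The class `PolyTime` contains the basic operations
on bits, lists and unary numbers and is closed under case distinction, bounded quantification and
iteration with polynomially bounded intermediate values (`PolyTime.iterate`), so the decision
procedure is in it by following its definition. Correctness is checked on encodings of instances;
`exists_encode_eq` shows that no other string passes the syntactic tests. -/

/-! ### Register programs and their compilation to stack Turing machines -/

/-- The stores of register programs: each register holds a bit string. -/
abbrev Store := ℕ → List Bool

/-- Structured programs acting on registers, each of which is a stack of bits. -/
inductive Prog
  | push (r : ℕ) (b : Bool)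
  | pop (r : ℕ)
  | seq (p q : Prog)
  | ite (r : ℕ) (p q : Prog)
  | loop (r : ℕ) (p : Prog)

namespace Prog

open Function Turing

/-- `Exec p s s' t`: the program `p`, started in the store `s`, stops in the store `s'` after
exactly `t` steps. -/
inductive Exec : Prog → Store → Store → ℕ → Prop
  | push (r b s) : Exec (push r b) s (update s r (b :: s r)) 1
  | pop (r s) : Exec (pop r) s (update s r (s r).tail) 1
  | seq {p q s s₁ s₂ t₁ t₂} : Exec p s s₁ t₁ → Exec q s₁ s₂ t₂ → Exec (seq p q) s s₂ (t₁ + t₂)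
  | ite_true {r p q s s' t} : (s r).head? = some true → Exec p s s' t →
      Exec (ite r p q) s s' (t + 1)
  | ite_false {r p q s s' t} : (s r).head? ≠ some true → Exec q s s' t →
      Exec (ite r p q) s s' (t + 1)
  | loop_nil {r p s} : s r = [] → Exec (loop r p) s s 1
  | loop_cons {r p s s₁ s₂ t₁ t₂} : s r ≠ [] → Exec p s s₁ t₁ → Exec (loop r p) s₁ s₂ t₂ →
      Exec (loop r p) s s₂ (t₁ + t₂ + 1)

/-- All registers of the program are below `N`. -/
def Below (N : ℕ) : Prog → Prop
  | push r _ => r < N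
  | pop r => r < N
  | seq p q => p.Below N ∧ q.Below N
  | ite r p q => r < N ∧ p.Below N ∧ q.Below N
  | loop r p => r < N ∧ p.Below N

theorem Below.mono {N M : ℕ} (h : N ≤ M) : ∀ {p : Prog}, p.Below N → p.Below M
  | push _ _, hp => lt_of_lt_of_le hp h
  | pop _, hp => lt_of_lt_of_le hp h
  | seq _ _, hp => ⟨hp.1.mono h, hp.2.mono h⟩
  | ite _ _ _, hp => ⟨lt_of_lt_of_le hp.1 h, hp.2.1.mono h, hp.2.2.mono h⟩
  | loop _ _, hp => ⟨lt_of_lt_of_le hp.1 h, hp.2.mono h⟩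

/-- A program mentions only finitely many registers, so finitely many stacks suffice to run it. -/
theorem exists_below (p : Prog) : ∃ N, p.Below N := by
  induction p with
  | push r b => exact ⟨r + 1, Nat.lt_succ_self r⟩
  | pop r => exact ⟨r + 1, Nat.lt_succ_self r⟩
  | seq p q hp hq =>
    obtain ⟨N, hN⟩ := hp
    obtain ⟨M, hM⟩ := hq
    exact ⟨max N M, hN.mono (le_max_left _ _), hM.mono (le_max_right _ _)⟩
  | ite r p q hp hq =>
    obtain ⟨N, hN⟩ := hp
    obtain ⟨M, hM⟩ := hq
    exact ⟨max (r + 1) (max N M), by omega, hN.mono (by omega), hM.mono (by omega)⟩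
  | loop r p hp =>
    obtain ⟨N, hN⟩ := hp
    exact ⟨max (r + 1) N, by omega, hN.mono (by omega)⟩

/-- The labels of the compiled program. -/
def Label : Prog → Type
  | push _ _ => Unit
  | pop _ => Unit
  | seq p q => p.Label ⊕ q.Label
  | ite _ p q => Option (p.Label ⊕ q.Label)
  | loop _ p => Option p.Label

instance fintypeLabel : ∀ p : Prog, Fintype p.Label
  | push _ _ => inferInstanceAs (Fintype Unit)
  | pop _ => inferInstanceAs (Fintype Unit)
  | seq p q => letI := fintypeLabel p; letI := fintypeLabel q
    inferInstanceAs (Fintype (p.Label ⊕ q.Label))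
  | ite _ p q => letI := fintypeLabel p; letI := fintypeLabel q
    inferInstanceAs (Fintype (Option (p.Label ⊕ q.Label)))
  | loop _ p => letI := fintypeLabel p; inferInstanceAs (Fintype (Option p.Label))

/-- The label where the compiled program starts. -/
def entry : ∀ p : Prog, p.Label
  | push _ _ => ()
  | pop _ => ()
  | seq p _ => Sum.inl p.entry
  | ite _ _ _ => none
  | loop _ _ => none

section Compile

variable (N : ℕ)

/-- The statements of the machines that compiled programs run on: `N + 1` stacks of bits and
an internal memory for the top of a stack. -/
abbrev MachineStmt (Λ : Type) : Type :=
  TM2.Stmt (K := Fin (N + 1)) (fun _ => Bool) Λ (Option Bool)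

/-- Jump to the first label if the test on the top of a stack succeeds, otherwise to the second. -/
def test {Λ : Type} (r : Fin (N + 1)) (f : Option Bool → Bool) (l l' : Λ) : MachineStmt N Λ :=
  -- The memory is reset to `none` on leaving the test, so that control always arrives at a label in
  -- a configuration of the form `config`.
  .peek r (fun _ o => o) (.branch f (.load (fun _ => none) (.goto fun _ => l))
    (.load (fun _ => none) (.goto fun _ => l')))

/-- The code of a program whose labels are placed by `emb` and that leaves to the label `exit`. -/
def code {Λ : Type} : ∀ (p : Prog) (_emb : p.Label → Λ) (_exit : Λ), p.Label → MachineStmt N Λ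
  | push r b, _, exit, _ => .push (Fin.ofNat (N + 1) r) (fun _ => b) (.goto fun _ => exit)
  | pop r, _, exit, _ => .pop (Fin.ofNat (N + 1) r) (fun v _ => v) (.goto fun _ => exit)
  | seq p q, emb, _, Sum.inl l => p.code (fun l => emb (Sum.inl l)) (emb (Sum.inr q.entry)) l
  | seq _ q, emb, exit, Sum.inr l => q.code (fun l => emb (Sum.inr l)) exit l
  | ite r p q, emb, _, none => test N (Fin.ofNat (N + 1) r) (fun v => v == some true)
      (emb (some (Sum.inl p.entry))) (emb (some (Sum.inr q.entry)))
  | ite _ p _, emb, exit, some (Sum.inl l) => p.code (fun l => emb (some (Sum.inl l))) exit l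
  | ite _ _ q, emb, exit, some (Sum.inr l) => q.code (fun l => emb (some (Sum.inr l))) exit l
  | loop r p, emb, exit, none => test N (Fin.ofNat (N + 1) r) Option.isSome
      (emb (some p.entry)) exit
  | loop _ p, emb, _, some l => p.code (fun l => emb (some l)) (emb none) l

/-- The configuration at a label with the stacks given by a store. -/
def config {Λ : Type} (l : Option Λ) (s : Store) :
    TM2.Cfg (K := Fin (N + 1)) (fun _ => Bool) Λ (Option Bool) :=
  ⟨l, none, fun k => s k⟩

variable {N}

/-- `Fin.ofNat` reduces modulo `N + 1`, which is harmless for registers below the bound. -/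
theorem update_store {r : ℕ} (hr : r < N + 1) (s : Store) (l : List Bool) :
    (fun k : Fin (N + 1) => update s r l k)
      = update (fun k : Fin (N + 1) => s k) (Fin.ofNat (N + 1) r) l := by
  have h : ∀ k : Fin (N + 1), k = Fin.ofNat (N + 1) r ↔ (k : ℕ) = r := fun k => by
    rw [Fin.ext_iff, Fin.val_ofNat, Nat.mod_eq_of_lt hr]
  funext k
  simp only [update_apply, h]

theorem store_ofNat {r : ℕ} (hr : r < N + 1) (s : Store) :
    s (Fin.ofNat (N + 1) r : Fin (N + 1)) = s r := by
  rw [Fin.val_ofNat, Nat.mod_eq_of_lt hr]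

theorem step_test {Λ : Type} (M : Λ → MachineStmt N Λ) {r : ℕ} (hr : r < N + 1)
    {f : Option Bool → Bool} {l₀ l l' : Λ} (h : M l₀ = test N (Fin.ofNat (N + 1) r) f l l')
    (s : Store) : TM2.step M (config N (some l₀) s)
      = some (config N (some (if f (s r).head? then l else l')) s) := by
  simp only [config, TM2.step, h, test, TM2.stepAux, store_ofNat hr]
  cases f (s r).head? <;> rfl

/-- A run of a program is a run of the same length of any machine containing its code. -/
theorem Exec.iterate {p : Prog} {s s' : Store} {t : ℕ} (h : Exec p s s' t) {Λ : Type}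
    (M : Λ → MachineStmt N Λ) (emb : p.Label → Λ) (exit : Λ) (hp : p.Below (N + 1))
    (hM : ∀ l, M (emb l) = p.code N emb exit l) :
    (flip bind (TM2.step M))^[t] (some (config N (some (emb p.entry)) s))
      = some (config N (some exit) s') := by
  -- The exit varies: the first half of a sequence leaves to the entry of the second half, and a
  -- loop body leaves to the test of its loop.
  induction h generalizing exit with
  | push r b s =>
    simp only [iterate_one, flip, Option.bind_eq_bind, Option.bind_some]
    simp only [config, TM2.step, hM, code, TM2.stepAux, store_ofNat hp, update_store hp]
  | pop r s =>
    simp only [iterate_one, flip, Option.bind_eq_bind, Option.bind_some]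
    simp only [config, TM2.step, hM, code, TM2.stepAux, store_ofNat hp, update_store hp]
  | seq h₁ h₂ ih₁ ih₂ =>
    rename_i p q s s₁ s₂ t₁ t₂
    rw [add_comm t₁, iterate_add_apply]
    have := ih₁ (fun l => emb (Sum.inl l)) _ hp.1 fun l => hM (Sum.inl l)
    rw [entry, this]
    exact ih₂ (fun l => emb (Sum.inr l)) _ hp.2 fun l => hM (Sum.inr l)
  | ite_true hr h ih =>
    rw [iterate_succ_apply]
    simp only [flip, Option.bind_eq_bind, Option.bind_some]
    rw [entry, step_test M hp.1 (hM none), hr]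
    exact ih (fun l => emb (some (Sum.inl l))) _ hp.2.1 fun l => hM (some (Sum.inl l))
  | ite_false hr h ih =>
    rw [iterate_succ_apply]
    simp only [flip, Option.bind_eq_bind, Option.bind_some]
    rw [entry, step_test M hp.1 (hM none), if_neg (by simpa using hr)]
    exact ih (fun l => emb (some (Sum.inr l))) _ hp.2.2 fun l => hM (some (Sum.inr l))
  | loop_nil hr =>
    simp only [iterate_one, flip, Option.bind_eq_bind, Option.bind_some]
    rw [entry, step_test M hp.1 (hM none), hr]
    rfl
  | loop_cons hr h₁ h₂ ih₁ ih₂ =>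
    rename_i r p s s₁ s₂ t₁ t₂
    rw [iterate_succ_apply]
    simp only [flip, Option.bind_eq_bind, Option.bind_some]
    rw [entry, step_test M hp.1 (hM none), add_comm t₁, iterate_add_apply]
    have h : (s r).head?.isSome = true := by
      cases h : s r with
      | nil => exact absurd h hr
      | cons => rfl
    rw [if_pos h]
    have := ih₁ (fun l => emb (some l)) _ hp.2 fun l => hM (some l)
    simp only [Option.bind_eq_bind] at this
    rw [this]
    exact ih₂ emb _ hp hM

end Compile

/-- The machine running a program on the input in register `0`, with output in register `1`. -/
def machine (p : Prog) (N : ℕ) : FinTM2 where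
  -- Two stacks more than the bound, so that the input stack `0` and the output stack `1` exist for
  -- every `N`.
  K := Fin (N + 2)
  k₀ := 0
  k₁ := 1
  Γ _ := Bool
  Λ := Option p.Label
  main := some p.entry
  σ := Option Bool
  initialState := none
  Γk₀Fin := inferInstanceAs (Fintype Bool)
  m
    | some l => p.code (N + 1) some none l
    | none => .halt

/-- A function computed by a program in polynomial time is computed by a Turing machine in
polynomial time. -/
theorem nonempty_computableInPolyTime (p : Prog) (P : Polynomial ℕ) (f : List Bool → Bool)
    (h : ∀ w, ∃ t ≤ P.eval w.length,
      Exec p (update (fun _ => []) 0 w) (update (fun _ => []) 1 [f w]) t) :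
    Nonempty (TM2ComputableInPolyTime (id : List Bool → List Bool) Computability.encodeBool f) := by
  obtain ⟨N, hN⟩ := p.exists_below
  choose t ht hrun using h
  -- The additional step executes `.halt` at the exit label.
  refine ⟨⟨⟨p.machine N, Equiv.refl Bool, Equiv.refl Bool⟩, P + 1, fun w =>
    ⟨⟨t w + 1, ?_⟩, by simpa using ht w⟩⟩⟩
  have hinit : initList (p.machine N) w = config (N + 1) (some (some p.entry))
      (update (fun _ => []) 0 w) := by
    simp only [initList, config, machine]
    congr 1
    funext k
    by_cases hk : k = 0
    · subst hk; simp; rfl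
    · simp [hk, Fin.val_eq_zero_iff]
  have hhalt : haltList (p.machine N) [f w] = config (N + 1) none (update (fun _ => []) 1 [f w]) := by
    simp only [haltList, config, machine]
    congr 1
    funext k
    by_cases hk : k = 1
    · subst hk; simp; rfl
    · have : (k : ℕ) ≠ 1 := fun h => hk (Fin.ext h)
      simp [hk, this]
  have hmap : ∀ l : List Bool, List.map (Equiv.refl Bool).invFun l = l := fun l => List.map_id l
  have := (hrun w).iterate (N := N + 1) (p.machine N).m some none
    (hN.mono (by omega)) (fun l => rfl)
  simp only [id]
  erw [hmap, hmap]
  rw [iterate_succ_apply', hinit]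
  erw [this]
  exact congrArg some hhalt.symm

end Prog

/-! ### Basic register programs -/

namespace Prog

open Function

/-- The program `p` leads from the store `s` to the store `s'` in at most `t` steps. -/
def Runs (p : Prog) (s s' : Store) (t : ℕ) : Prop :=
  ∃ t' ≤ t, Exec p s s' t'

theorem Runs.mono {p : Prog} {s s' : Store} {t t' : ℕ} (h : Runs p s s' t) (ht : t ≤ t') :
    Runs p s s' t' :=
  let ⟨u, hu, he⟩ := h
  ⟨u, hu.trans ht, he⟩

theorem Runs.congr {p : Prog} {s s₁ s₂ : Store} {t t' : ℕ} (h : Runs p s s₁ t) (hs : s₁ = s₂)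
    (ht : t ≤ t') : Runs p s s₂ t' :=
  hs ▸ h.mono ht

theorem runs_push (r : ℕ) (b : Bool) (s : Store) :
    Runs (push r b) s (update s r (b :: s r)) 1 :=
  ⟨1, le_rfl, .push r b s⟩

theorem runs_pop (r : ℕ) (s : Store) : Runs (pop r) s (update s r (s r).tail) 1 :=
  ⟨1, le_rfl, .pop r s⟩

theorem Runs.seq {p q : Prog} {s s₁ s₂ : Store} {t₁ t₂ : ℕ} (h₁ : Runs p s s₁ t₁)
    (h₂ : Runs q s₁ s₂ t₂) : Runs (seq p q) s s₂ (t₁ + t₂) :=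
  let ⟨_, hu, he⟩ := h₁
  let ⟨_, hv, hf⟩ := h₂
  ⟨_, add_le_add hu hv, he.seq hf⟩

theorem Runs.ite {p q : Prog} {r : ℕ} {s s' : Store} {t : ℕ}
    (h : Runs (if (s r).head? = some true then p else q) s s' t) :
    Runs (ite r p q) s s' (t + 1) := by
  obtain ⟨u, hu, he⟩ := h
  refine ⟨u + 1, by omega, ?_⟩
  split_ifs at he with h
  · exact .ite_true h he
  · exact .ite_false h he

theorem runs_loop_nil {r : ℕ} {p : Prog} {s : Store} (h : s r = []) : Runs (loop r p) s s 1 :=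
  ⟨1, le_rfl, .loop_nil h⟩

theorem Runs.loop {r : ℕ} {p : Prog} {s s₁ s₂ : Store} {t₁ t₂ : ℕ} (h : s r ≠ [])
    (h₁ : Runs p s s₁ t₁) (h₂ : Runs (loop r p) s₁ s₂ t₂) :
    Runs (loop r p) s s₂ (t₁ + t₂ + 1) :=
  let ⟨_, hu, he⟩ := h₁
  let ⟨_, hv, hf⟩ := h₂
  ⟨_, by omega, .loop_cons h he hf⟩

/-- Registers grow by at most one in each step. -/
theorem Exec.length_le {p : Prog} {s s' : Store} {t : ℕ} (h : Exec p s s' t) (r : ℕ) :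
    (s' r).length ≤ (s r).length + t := by
  induction h with
  | push r' b s => by_cases hr : r = r' <;> simp [hr]
  | pop r' s => by_cases hr : r = r' <;> simp [hr]; omega
  | seq _ _ _ _ => omega
  | ite_true _ _ _ => omega
  | ite_false _ _ _ => omega
  | loop_nil _ => omega
  | loop_cons _ _ _ _ _ => omega

theorem Runs.length_le {p : Prog} {s s' : Store} {t : ℕ} (h : Runs p s s' t) (r : ℕ) :
    (s' r).length ≤ (s r).length + t :=
  let ⟨_, hu, he⟩ := h
  (he.length_le r).trans (by omega)

/-- Empty the register `r`. -/
def clear (r : ℕ) : Prog := loop r (pop r)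

theorem runs_clear (r : ℕ) (s : Store) :
    Runs (clear r) s (update s r []) (2 * (s r).length + 1) := by
  generalize hl : s r = l
  induction l generalizing s with
  | nil =>
    rw [← hl, update_eq_self]
    exact (runs_loop_nil hl).mono (by omega)
  | cons b l ih =>
    have := Runs.loop (by simp [hl]) (runs_pop r s) (ih (update s r (s r).tail) (by simp [hl]))
    rw [update_idem] at this
    exact this.mono (by simp; omega)

/-- Move the contents of register `i`, in reversed order, onto register `j`. -/
def shift (i j : ℕ) : Prog := loop i (seq (ite i (push j true) (push j false)) (pop i))

theorem runs_shift {i j : ℕ} (hij : i ≠ j) (s : Store) :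
    Runs (shift i j) s (update (update s i []) j ((s i).reverse ++ s j))
      (4 * (s i).length + 1) := by
  generalize hl : s i = l
  induction l generalizing s with
  | nil =>
    have : update (update s i []) j ([].reverse ++ s j) = s := by
      rw [← hl, update_eq_self]; simp [hl]
    rw [this]
    exact (runs_loop_nil hl).mono (by omega)
  | cons b l ih =>
    have h₁ : Runs (ite i (push j true) (push j false)) s (update s j (b :: s j)) 2 := by
      apply Runs.ite
      cases b
      · simpa [hl] using runs_push j false s
      · simpa [hl] using runs_push j true s
    have h₂ := h₁.seq (runs_pop i _)
    have h := Runs.loop (by simp [hl]) h₂ (ih _ (by simp [hij, hl]))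
    refine h.congr ?_ (by simp; omega)
    funext r
    by_cases hr : r = j
    · subst hr; simp [hij.symm]
    · by_cases hi : r = i
      · subst hi; simp [hr]
      · simp [hr, hi]

/-- Move the contents of register `i` to the empty register `j`, where `c` is an empty auxiliary
register. -/
def move (i j c : ℕ) : Prog := seq (shift i c) (shift c j)

theorem runs_move {i j c : ℕ} (hij : i ≠ j) (hic : i ≠ c) (hjc : j ≠ c) {s : Store}
    (hj : s j = []) (hc : s c = []) :
    Runs (move i j c) s (update (update s i []) j (s i)) (8 * (s i).length + 2) := by
  have h := (runs_shift hic s).seq (runs_shift hjc.symm _)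
  refine h.congr ?_ ?_
  · funext r
    by_cases hr : r = j
    · subst hr; simp [hjc, hij.symm, hj, hc]
    · by_cases hi : r = i
      · subst hi; simp [hr, hic]
      · by_cases hcr : r = c
        · subst hcr; simp [hr, hi, hc]
        · simp [hr, hi, hcr]
  · simp [hc]; omega

/-- Move the contents of register `i`, in reversed order, onto registers `j` and `c`. -/
def shift₂ (i j c : ℕ) : Prog :=
  loop i (seq (ite i (seq (push j true) (push c true)) (seq (push j false) (push c false))) (pop i))

theorem runs_shift₂ {i j c : ℕ} (hij : i ≠ j) (hic : i ≠ c) (hjc : j ≠ c) (s : Store) :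
    Runs (shift₂ i j c) s
      (update (update (update s i []) j ((s i).reverse ++ s j)) c ((s i).reverse ++ s c))
      (5 * (s i).length + 1) := by
  generalize hl : s i = l
  induction l generalizing s with
  | nil =>
    have : update (update (update s i []) j ([].reverse ++ s j)) c ([].reverse ++ s c) = s := by
      rw [← hl, update_eq_self]; simp [hl]
    rw [this]
    exact (runs_loop_nil hl).mono (by omega)
  | cons b l ih =>
    have h₁ : Runs (ite i (seq (push j true) (push c true)) (seq (push j false) (push c false))) s
        (update (update s j (b :: s j)) c (b :: s c)) 3 := by
      apply Runs.ite
      cases b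
      · have := (runs_push j false s).seq (runs_push c false _)
        simpa [hl, hjc.symm] using this
      · have := (runs_push j true s).seq (runs_push c true _)
        simpa [hl, hjc.symm] using this
    have h₂ := h₁.seq (runs_pop i _)
    have h := Runs.loop (by simp [hl]) h₂ (ih _ (by simp [hij, hic, hl]))
    refine h.congr ?_ (by simp; omega)
    funext r
    by_cases hr : r = j
    · subst hr; simp [hij.symm, hjc]
    · by_cases hi : r = i
      · subst hi; simp [hr, hic]
      · by_cases hcr : r = c
        · subst hcr; simp [hi]
        · simp [hr, hi, hcr]

/-- Copy register `i` to the empty register `j`, where `c` is an empty auxiliary register. -/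
def copy (i j c : ℕ) : Prog := seq (shift i c) (shift₂ c i j)

theorem runs_copy {i j c : ℕ} (hij : i ≠ j) (hic : i ≠ c) (hjc : j ≠ c) {s : Store}
    (hj : s j = []) (hc : s c = []) :
    Runs (copy i j c) s (update s j (s i)) (9 * (s i).length + 2) := by
  have h := (runs_shift hic s).seq (runs_shift₂ hic.symm hjc.symm hij _)
  refine h.congr ?_ (by simp [hc]; omega)
  funext r
  by_cases hr : r = j
  · subst hr; simp [hij.symm, hjc, hc, hj]
  · by_cases hi : r = i
    · subst hi; simp [hr, hic, hc]
    · by_cases hcr : r = c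
      · subst hcr; simp [hr, hi, hc]
      · simp [hr, hi, hcr]

/-- Replace the contents of register `i` by those of register `j` and empty register `j`, where
`c` is an empty auxiliary register. -/
def replace (i j c : ℕ) : Prog := seq (clear i) (move j i c)

theorem runs_replace {i j c : ℕ} (hij : i ≠ j) (hic : i ≠ c) (hjc : j ≠ c) {s : Store}
    (hc : s c = []) :
    Runs (replace i j c) s (update (update s j []) i (s j))
      (2 * (s i).length + 8 * (s j).length + 3) := by
  have h := (runs_clear i s).seq (runs_move (s := update s i []) hij.symm hjc hic (by simp)
    (by simp [hic.symm, hc]))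
  rw [update_of_ne hij.symm, update_comm hij, update_idem] at h
  exact h.mono (by omega)

end Prog

/-! ### Functions computed by register programs in polynomial time -/

/-- The coefficients are natural numbers, so bounds on sizes can be substituted into time bounds. -/
theorem Polynomial.eval_le_eval_of_le (P : Polynomial ℕ) {x y : ℕ} (h : x ≤ y) :
    P.eval x ≤ P.eval y := by
  rw [Polynomial.eval_eq_sum_range, Polynomial.eval_eq_sum_range]
  exact Finset.sum_le_sum fun i _ => Nat.mul_le_mul_left _ (Nat.pow_le_pow_left h i)

/-- Data types whose values are represented in one register. -/
class Enc (β : Type) where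
  enc : β → List Bool

/-- Contexts, whose values are represented in finitely many registers. -/
class Ctx (α : Type) where
  width : ℕ
  regs : α → ℕ → List Bool

open Enc Ctx Function

instance : Enc Bool := ⟨fun b => [b]⟩

instance : Enc ℕ := ⟨fun n => List.replicate n true⟩

instance : Enc (List Bool) := ⟨id⟩

instance {β : Type} [Enc β] : Ctx β := ⟨1, fun b _ => enc b⟩

instance {α β : Type} [Ctx α] [Enc β] : Ctx (α × β) :=
  ⟨width α + 1, fun q i => if i = width α then enc q.2 else regs q.1 i⟩

/-- The total length of the registers of a context. -/
def Ctx.size {α : Type} [Ctx α] (a : α) : ℕ :=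
  ∑ i ∈ Finset.range (width α), (regs a i).length

section

variable {α β γ : Type} [Ctx α] [Enc β] [Enc γ]

theorem length_enc_nat (n : ℕ) : (enc n).length = n := List.length_replicate

theorem size_prod (a : α) (b : β) : size (a, b) = size a + (enc b).length := by
  have h : width (α × β) = width α + 1 := rfl
  rw [size, h, Finset.sum_range_succ]
  congr 1
  · refine Finset.sum_congr rfl fun i hi => ?_
    simp [regs, (Finset.mem_range.1 hi).ne]
  · simp [regs]

theorem length_regs_le_size (a : α) {i : ℕ} (hi : i < width α) : (regs a i).length ≤ size a :=
  Finset.single_le_sum (f := fun i => (regs a i).length) (fun _ _ => Nat.zero_le _)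
    (Finset.mem_range.2 hi)

/-- The registers `ρ 0, ρ 1, …` of the store hold the context `a`. -/
def Holds (ρ : ℕ → ℕ) (a : α) (s : Store) : Prop :=
  ∀ i < width α, s (ρ i) = regs a i

/-- All registers from `k` on are empty. -/
def Free (k : ℕ) (s : Store) : Prop :=
  ∀ i, k ≤ i → s i = []

/-- A function is computed by register programs in polynomial time. The programs find their input
in arbitrary registers, leave it unchanged and put their output in the first free register. -/
def PolyTime (f : α → β) : Prop :=
  ∀ (ρ : ℕ → ℕ) (k : ℕ), (∀ i < width α, ρ i < k) → ∃ (p : Prog) (P : Polynomial ℕ),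
    ∀ (a : α) (s : Store), Holds ρ a s → Free k s →
      p.Runs s (update s k (enc (f a))) (P.eval (size a))

theorem Holds.update {ρ : ℕ → ℕ} {a : α} {s : Store} (h : Holds ρ a s) {k : ℕ}
    (hk : ∀ i < width α, ρ i < k) {j : ℕ} (hj : k ≤ j) (l : List Bool) :
    Holds ρ a (update s j l) := fun i hi => by
  rw [update_of_ne (by have := hk i hi; omega), h i hi]

theorem Holds.prod {ρ : ℕ → ℕ} {a : α} {s : Store} (h : Holds ρ a s) {k : ℕ} {b : β}
    (hb : s k = enc b) : Holds (Function.update ρ (width α) k) (a, b) s := fun i hi => by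
  have h' : width (α × β) = width α + 1 := rfl
  by_cases hi' : i = width α
  · subst hi'; simp [regs, hb]
  · rw [update_of_ne hi', h i (by omega)]
    simp [regs, hi']

theorem forall_update_lt {ρ : ℕ → ℕ} {k k' j : ℕ} (h : ∀ i < width α, ρ i < k) (hk : k ≤ k')
    (hj : j < k') : ∀ i < width (α × β), Function.update ρ (width α) j i < k' := fun i hi => by
  have h' : width (α × β) = width α + 1 := rfl
  by_cases hi' : i = width α
  · subst hi'; simpa using hj
  · rw [update_of_ne hi']
    exact (h i (by omega)).trans_le hk

theorem Free.update {k j : ℕ} {s : Store} (h : Free k s) (hj : j < k) (l : List Bool) :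
    Free k (update s j l) := fun i hi => by
  rw [update_of_ne (by omega), h i hi]

theorem Free.mono {k k' : ℕ} {s : Store} (h : Free k s) (hk : k ≤ k') : Free k' s :=
  fun i hi => h i (hk.trans hi)

/-- A step lengthens a register by at most one, so the time bound also bounds the output. This
controls the sizes of intermediate values in compositions. -/
theorem PolyTime.length_le {f : α → β} (hf : PolyTime f) :
    ∃ P : Polynomial ℕ, ∀ a, (enc (f a)).length ≤ P.eval (size a) := by
  obtain ⟨p, P, hP⟩ := hf id (width α) fun _ hi => hi
  refine ⟨P, fun a => ?_⟩
  have := (hP a (fun i => if i < width α then regs a i else []) (fun _ hi => if_pos hi)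
    fun i hi => if_neg (by omega)).length_le (width α)
  simpa using this

theorem PolyTime.congr {f g : α → β} (hf : PolyTime f) (h : ∀ a, f a = g a) : PolyTime g :=
  (funext h : f = g) ▸ hf

/-- Substitution of a context whose registers are among those of another context. -/
theorem PolyTime.rewire {α' : Type} [Ctx α'] {f : α → β} (hf : PolyTime f) (g : α' → α)
    (τ : ℕ → ℕ) (h : ∀ i < width α, τ i < width α' ∧ ∀ a, regs (g a) i = regs a (τ i)) :
    PolyTime fun a => f (g a) := by
  intro ρ k hk
  obtain ⟨p, P, hP⟩ := hf (ρ ∘ τ) k fun i hi => hk _ (h i hi).1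
  -- Since `τ` may repeat a register, each of the `width α` registers is bounded separately by the
  -- size of the whole context.
  refine ⟨p, P.comp (Polynomial.C (width α) * Polynomial.X), fun a s hs hf => ?_⟩
  refine (hP (g a) s (fun i hi => ?_) hf).mono ?_
  · rw [comp_apply, hs _ (h i hi).1, (h i hi).2]
  · rw [Polynomial.eval_comp]
    apply Polynomial.eval_le_eval_of_le
    have := Finset.sum_le_card_nsmul (Finset.range (width α)) (fun i => (regs (g a) i).length)
      (size a) fun i hi => by
        have hi := h i (Finset.mem_range.1 hi)
        rw [hi.2]
        exact length_regs_le_size a hi.1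
    simpa [size] using this

/-- A value kept in a register. -/
theorem polyTime_reg {f : α → β} {i : ℕ} (hi : i < width α) (h : ∀ a, regs a i = enc (f a)) :
    PolyTime f := by
  intro ρ k hk
  refine ⟨.copy (ρ i) k (k + 1), 9 * Polynomial.X + 2, fun a s hs hf => ?_⟩
  have := hk i hi
  refine (Prog.runs_copy (i := ρ i) (j := k) (c := k + 1) (by omega) (by omega) (by omega)
    (hf _ le_rfl) (hf _ (by omega))).congr ?_ ?_
  · rw [hs i hi, h]
  · rw [hs i hi]
    simpa using length_regs_le_size a hi

theorem polyTime_id : PolyTime fun b : β => b :=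
  polyTime_reg (i := 0) Nat.one_pos fun _ => rfl

theorem polyTime_snd : PolyTime fun q : α × β => q.2 :=
  polyTime_reg (i := width α) (Nat.lt_succ_self _) fun _ => if_pos rfl

theorem PolyTime.fst {f : α → β} (hf : PolyTime f) : PolyTime fun q : α × γ => f q.1 :=
  hf.rewire Prod.fst id fun _ hi =>
    ⟨Nat.lt_succ_of_lt hi, fun _ => (if_neg (Nat.ne_of_lt hi)).symm⟩

theorem polyTime_const (b : β) : PolyTime fun _ : α => b := by
  intro ρ k _
  have h : ∀ l : List Bool, ∃ (p : Prog) (t : ℕ), ∀ s : Store, Free k s →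
      p.Runs s (update s k l) t := by
    intro l
    induction l with
    | nil => exact ⟨.clear k, 1, fun s hf => (Prog.runs_clear k s).mono (by simp [hf k le_rfl])⟩
    | cons b l ih =>
      obtain ⟨p, t, hp⟩ := ih
      refine ⟨.seq p (.push k b), t + 1, fun s hf => ?_⟩
      simpa using (hp s hf).seq (Prog.runs_push k b _)
  obtain ⟨p, t, hp⟩ := h (enc b)
  exact ⟨p, Polynomial.C t, fun a s _ hf => by simpa using hp s hf⟩

/-- Postcomposition with a function computed in place. -/
theorem PolyTime.inplace {f : α → β} (hf : PolyTime f) (g : β → γ) (q : ℕ → Prog)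
    (Q : Polynomial ℕ) (hq : ∀ k s b, s k = enc b → Free (k + 1) s →
      (q k).Runs s (update s k (enc (g b))) (Q.eval (enc b).length)) :
    PolyTime fun a => g (f a) := by
  intro ρ k hk
  obtain ⟨F, hF⟩ := hf.length_le
  obtain ⟨p, P, hP⟩ := hf ρ k hk
  refine ⟨.seq p (q k), P + Q.comp F, fun a s hs hfr => ?_⟩
  refine ((hP a s hs hfr).seq (hq k _ (f a) (update_self ..)
    ((hfr.mono (by omega)).update (by omega) _))).congr ?_ ?_
  · rw [update_idem]
  · rw [Polynomial.eval_add, Polynomial.eval_comp]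
    exact Nat.add_le_add_left (Q.eval_le_eval_of_le (hF a)) _

theorem PolyTime.ite {c : α → Bool} {f g : α → β} (hc : PolyTime c) (hf : PolyTime f)
    (hg : PolyTime g) : PolyTime fun a => if c a then f a else g a := by
  intro ρ k hk
  obtain ⟨p, P, hP⟩ := hc ρ k hk
  obtain ⟨q, Q, hQ⟩ := hf ρ k hk
  obtain ⟨r, R, hR⟩ := hg ρ k hk
  refine ⟨.seq p (.ite k (.seq (.pop k) q) (.seq (.pop k) r)), P + (1 + (Q + R) + 1),
    fun a s hs hfr => ?_⟩
  have h : (if (update s k (enc (c a)) k).head? = some true then Prog.seq (.pop k) q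
      else .seq (.pop k) r).Runs (update s k (enc (c a)))
        (update s k (enc (if c a then f a else g a))) (1 + (Q.eval (size a) + R.eval (size a))) := by
    have h₁ := Prog.runs_pop k (update s k (enc (c a)))
    -- Popping the tested bit empties register `k` again, so either branch starts from the original
    -- store.
    have h₂ : update (update s k (enc (c a))) k (update s k (enc (c a)) k).tail = s := by
      rw [update_idem, update_self]
      exact (congrArg _ (hfr k le_rfl).symm).trans (update_eq_self k s)
    rw [h₂] at h₁
    cases h : c a
    · have := h₁.seq (hR a s hs hfr)
      simpa [h, enc] using this.mono (by omega)
    · have := h₁.seq (hQ a s hs hfr)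
      simpa [h, enc] using this.mono (by omega)
  refine ((hP a s hs hfr).seq h.ite).mono ?_
  simp

/-- Bounded iteration. -/
def iter (b : β) (step : ℕ → β → β) : ℕ → β
  | 0 => b
  | i + 1 => step i (iter b step i)

/-- Register `k` holds the current value, `k + 1` the number of rounds left, `k + 2` the number of
rounds done; `k + 3` receives the new value and `k + 4` is auxiliary. The bound `B` is needed
because repeating a polynomial-time step could otherwise let the value grow superpolynomially. -/
theorem PolyTime.iterate {n : α → ℕ} {f : α → β} {g : (α × β) × ℕ → β} (hn : PolyTime n)
    (hf : PolyTime f) (hg : PolyTime g) (B : Polynomial ℕ)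
    (hB : ∀ a, ∀ i ≤ n a,
      (enc (iter (f a) (fun i b => g ((a, b), i)) i)).length ≤ B.eval (size a)) :
    PolyTime fun a => iter (f a) (fun i b => g ((a, b), i)) (n a) := by
  intro ρ k hk
  obtain ⟨N, hN⟩ := hn.length_le
  obtain ⟨p, P, hP⟩ := hf ρ k hk
  obtain ⟨q, Q, hQ⟩ := hn ρ (k + 1) fun i hi => Nat.lt_succ_of_lt (hk i hi)
  obtain ⟨r, R, hR⟩ := hg (update (update ρ (width α) k) (width (α × β)) (k + 2)) (k + 3)
    (forall_update_lt (k := k + 1) (forall_update_lt hk (by omega) (by omega)) (by omega)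
      (by omega))
  let body := Prog.seq r (.seq (.replace k (k + 3) (k + 4)) (.seq (.push (k + 2) true)
    (.pop (k + 1))))
  -- The cost of one round: the step function on a context of size at most `size a + B + N`, then
  -- the replacement of the old value, then one push and one pop.
  let T := R.comp (Polynomial.X + B + N) + (2 * B + 8 * B + 3 + (1 + 1))
  refine ⟨.seq p (.seq q (.seq (.loop (k + 1) body) (.clear (k + 2)))),
    P + (Q + (N * (T + 1) + 1 + (2 * N + 1))), fun a s hs hfr => ?_⟩
  set v := iter (f a) (fun i b => g ((a, b), i)) with hv
  -- The store after `i` rounds with `m` rounds left.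
  let S : ℕ → ℕ → Store := fun i m =>
    update (update (update s k (enc (v i))) (k + 1) (enc m)) (k + 2) (enc i)
  have hbody : ∀ i m, i + m + 1 = n a → body.Runs (S i (m + 1)) (S (i + 1) m) (T.eval (size a)) := by
    intro i m him
    have e₁ : (enc (v i)).length ≤ B.eval (size a) := hB a i (by omega)
    have e₂ := hB a (i + 1) (by omega)
    have e₃ : i ≤ N.eval (size a) := by
      have := hN a
      rw [length_enc_nat] at this
      omega
    have hh : Holds (update (update ρ (width α) k) (width (α × β)) (k + 2)) ((a, v i), i)
        (S i (m + 1)) := by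
      refine Holds.prod (Holds.prod ?_ ?_) ?_
      · exact ((hs.update hk le_rfl _).update hk (by omega) _).update hk (by omega) _
      · simp [S]
      · simp [S]
    have h₁ := hR ((a, v i), i) (S i (m + 1)) hh ((((hfr.mono (by omega)).update (by omega) _).update
      (by omega) _).update (by omega) _)
    have h₂ := Prog.runs_replace (i := k) (j := k + 3) (c := k + 4) (by omega) (by omega)
      (by omega) (s := update (S i (m + 1)) (k + 3) (enc (g ((a, v i), i))))
      (by simpa [S] using hfr (k + 4) (by omega))
    refine (h₁.seq (h₂.seq ((Prog.runs_push (k + 2) true _).seq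
      (Prog.runs_pop (k + 1) _)))).congr ?_ ?_
    · funext j
      by_cases hj : j = k
      · subst hj; simp [S, v, iter]
      · by_cases hj₁ : j = k + 1
        · subst hj₁; simp [S, enc]
        · by_cases hj₂ : j = k + 2
          · subst hj₂; simp [S, enc, List.replicate_succ]
          · by_cases hj₃ : j = k + 3
            · subst hj₃; simpa [S] using (hfr (k + 3) (by omega)).symm
            · simp [S, hj, hj₁, hj₂, hj₃]
    · have e₄ : size ((a, v i), i) ≤ size a + B.eval (size a) + N.eval (size a) := by
        rw [size_prod, size_prod, length_enc_nat]
        omega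
      have e₅ := R.eval_le_eval_of_le e₄
      have e₆ : (S i (m + 1) k).length ≤ B.eval (size a) := by simpa [S] using e₁
      have e₇ : (enc (g ((a, v i), i))).length ≤ B.eval (size a) := e₂
      simp only [T, update_self, Polynomial.eval_add, Polynomial.eval_comp, Polynomial.eval_mul,
        Polynomial.eval_X, Polynomial.eval_ofNat, Polynomial.eval_one]
      rw [update_of_ne (by omega)]
      omega
  have hloop : ∀ m i, i + m = n a → (Prog.loop (k + 1) body).Runs (S i m) (S (n a) 0)
      (m * (T.eval (size a) + 1) + 1) := by
    intro m
    induction m with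
    | zero =>
      rintro i rfl
      exact (Prog.runs_loop_nil (by simp [S, enc])).mono (by omega)
    | succ m ih =>
      intro i hi
      refine (Prog.Runs.loop (by simp [S, enc]) (hbody i m (by omega))
        (ih (i + 1) (by omega))).mono ?_
      rw [Nat.succ_mul]
      omega
  have h₁ := hP a s hs hfr
  have h₂ := hQ a (update s k (enc (f a))) (hs.update hk le_rfl _) ((hfr.mono (by omega)).update (by omega) _)
  have h₃ : update (update s k (enc (f a))) (k + 1) (enc (n a)) = S 0 (n a) := by
    funext j
    by_cases hj : j = k + 2
    · subst hj; simpa [S, enc] using hfr (k + 2) (by omega)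
    · simp [S, hj, v, iter]
  rw [h₃] at h₂
  refine (h₁.seq (h₂.seq ((hloop (n a) 0 (by omega)).seq (Prog.runs_clear (k + 2) _)))).congr ?_ ?_
  · funext j
    by_cases hj : j = k
    · subst hj; simp [S, v]
    · by_cases hj₁ : j = k + 1
      · subst hj₁; simpa [S, enc] using (hfr (k + 1) (by omega)).symm
      · by_cases hj₂ : j = k + 2
        · subst hj₂; simpa [S, enc] using (hfr (k + 2) (by omega)).symm
        · simp [S, hj, hj₁, hj₂]
  · have hNa := hN a
    rw [length_enc_nat] at hNa
    have e : (S (n a) 0 (k + 2)).length = n a := by simp [S, length_enc_nat]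
    have := Nat.mul_le_mul_right (T.eval (size a) + 1) hNa
    simp only [Polynomial.eval_add, Polynomial.eval_mul, Polynomial.eval_ofNat,
      Polynomial.eval_one, e]
    omega

end

section

variable {α β β₁ γ : Type} [Ctx α] [Enc β] [Enc β₁] [Enc γ]

/-- Weakening by a register below the last one. -/
theorem PolyTime.skip {f : α × β → γ} (hf : PolyTime f) :
    PolyTime fun q : (α × β₁) × β => f (q.1.1, q.2) := by
  refine hf.rewire (fun q : (α × β₁) × β => (q.1.1, q.2))
    (fun i => if i = width α then width α + 1 else i) fun i hi => ?_
  have h₁ : width (α × β) = width α + 1 := rfl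
  have h₂ : width (α × β₁) = width α + 1 := rfl
  have h₃ : width ((α × β₁) × β) = width α + 2 := rfl
  by_cases h : i = width α
  · subst h
    simp [regs, h₂, h₃]
  · have : i ≠ width α + 1 := by omega
    have : i < width α + 2 := by omega
    simp [regs, *]

/-! #### Boolean functions -/

theorem PolyTime.not {f : α → Bool} (hf : PolyTime f) : PolyTime fun a => !f a :=
  (hf.ite (polyTime_const false) (polyTime_const true)).congr fun a => by cases f a <;> rfl

theorem PolyTime.and {f g : α → Bool} (hf : PolyTime f) (hg : PolyTime g) :
    PolyTime fun a => f a && g a :=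
  (hf.ite hg (polyTime_const false)).congr fun a => by cases f a <;> rfl

theorem PolyTime.or {f g : α → Bool} (hf : PolyTime f) (hg : PolyTime g) :
    PolyTime fun a => f a || g a :=
  (hf.ite (polyTime_const true) hg).congr fun a => by cases f a <;> rfl

/-! #### Lists -/

theorem PolyTime.tail {f : α → List Bool} (hf : PolyTime f) : PolyTime fun a => (f a).tail :=
  hf.inplace List.tail .pop 1 fun k s b hb _ => by
    simpa [enc, hb] using Prog.runs_pop k s

theorem PolyTime.cons {b : α → Bool} {f : α → List Bool} (hb : PolyTime b) (hf : PolyTime f) :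
    PolyTime fun a => b a :: f a := by
  have h : ∀ c : Bool, PolyTime fun a => c :: f a := fun c =>
    hf.inplace (List.cons c) (fun k => .push k c) 1 fun k s b hb _ => by
      simpa [enc, hb] using Prog.runs_push k c s
  exact (hb.ite (h true) (h false)).congr fun a => by cases b a <;> rfl

theorem PolyTime.headD {f : α → List Bool} (hf : PolyTime f) :
    PolyTime fun a => (f a).headD false := by
  refine hf.inplace (fun l => l.headD false)
    (fun k => .ite k (.seq (.clear k) (.push k true)) (.seq (.clear k) (.push k false)))
    (2 * Polynomial.X + 3) fun k s l hl _ => ?_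
  have h := fun c => (Prog.runs_clear k s).seq (Prog.runs_push k c _)
  refine (Prog.Runs.ite (s' := update s k [l.headD false]) (t := 2 * l.length + 2) ?_).mono
    (by simp [enc])
  have hl' : s k = l := hl
  rw [hl']
  split_ifs with hh
  · have : l.headD false = true := by rw [List.headD_eq_head?_getD, hh]; rfl
    rw [this]
    simpa [hl'] using h true
  · have : l.headD false = false := by
      cases l with
      | nil => rfl
      | cons b l => simpa using hh
    rw [this]
    simpa [hl'] using h false

theorem PolyTime.reverse {f : α → List Bool} (hf : PolyTime f) :
    PolyTime fun a => (f a).reverse := by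
  refine hf.inplace List.reverse (fun k => .seq (.shift k (k + 1)) (.replace k (k + 1) (k + 2)))
    (12 * Polynomial.X + 4) fun k s l hl hfr => ?_
  have h := (Prog.runs_shift (i := k) (j := k + 1) (by omega) s).seq
    (Prog.runs_replace (i := k) (j := k + 1) (c := k + 2) (by omega) (by omega) (by omega)
      (by simp [hfr (k + 2) (by omega)]))
  have hl' : s k = l := hl
  refine h.congr ?_ ?_
  · funext i
    by_cases hi : i = k
    · subst hi; simp [hl', hfr (i + 1) le_rfl, enc]
    · by_cases hi' : i = k + 1
      · subst hi'; simp [hfr (k + 1) le_rfl]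
      · simp [hi, hi']
  · simp [hl', hfr (k + 1) le_rfl, enc]
    omega

/-- Empty register `i` and push a `true` onto register `j` for each of its elements. -/
def Prog.count (i j : ℕ) : Prog := .loop i (.seq (.pop i) (.push j true))

theorem Prog.runs_count {i j : ℕ} (hij : i ≠ j) (s : Store) :
    Runs (count i j) s (update (update s i []) j (List.replicate (s i).length true ++ s j))
      (3 * (s i).length + 1) := by
  generalize hl : s i = l
  induction l generalizing s with
  | nil =>
    refine (runs_loop_nil hl).congr ?_ (by simp)
    rw [← hl, update_eq_self]; simp [hl]
  | cons b l ih =>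
    have h := Runs.loop (by simp [hl]) ((runs_pop i s).seq (runs_push j true _))
      (ih _ (by simp [hij, hl]))
    refine h.congr ?_ (by simp; omega)
    funext r
    by_cases hr : r = j
    · subst hr
      simp [hij.symm, List.replicate_succ']
    · by_cases hi : r = i
      · subst hi; simp [hr]
      · simp [hr, hi]

theorem PolyTime.length {f : α → List Bool} (hf : PolyTime f) :
    PolyTime fun a => (f a).length := by
  refine hf.inplace List.length (fun k => .seq (.count k (k + 1)) (.replace k (k + 1) (k + 2)))
    (11 * Polynomial.X + 4) fun k s l hl hfr => ?_
  have h := (Prog.runs_count (i := k) (j := k + 1) (by omega) s).seq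
    (Prog.runs_replace (i := k) (j := k + 1) (c := k + 2) (by omega) (by omega) (by omega)
      (by simp [hfr (k + 2) (by omega)]))
  have hl' : s k = l := hl
  refine h.congr ?_ ?_
  · funext i
    by_cases hi : i = k
    · subst hi; simp [hl', hfr (i + 1) le_rfl, enc]
    · by_cases hi' : i = k + 1
      · subst hi'; simp [hfr (k + 1) le_rfl]
      · simp [hi, hi']
  · simp [hl', hfr (k + 1) le_rfl, enc]
    omega

/-! #### Natural numbers -/

theorem PolyTime.succ {f : α → ℕ} (hf : PolyTime f) : PolyTime fun a => f a + 1 :=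
  hf.inplace Nat.succ (fun k => .push k true) 1 fun k s b hb _ => by
    simpa [enc, hb, List.replicate_succ] using Prog.runs_push k true s

theorem PolyTime.pred {f : α → ℕ} (hf : PolyTime f) : PolyTime fun a => f a - 1 :=
  hf.inplace Nat.pred .pop 1 fun k s b hb _ => by
    simpa [enc, hb] using Prog.runs_pop k s

theorem PolyTime.ne_zero {f : α → ℕ} (hf : PolyTime f) : PolyTime fun a => decide (f a ≠ 0) := by
  have h : PolyTime fun a => (id (List.replicate (f a) true)) :=
    -- A number and its string of `true`s have the same code, so a program without net effect
    -- converts one into the other.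
    hf.inplace (fun n => (List.replicate n true : List Bool))
      (fun k => .seq (.push k true) (.pop k)) 2 fun k s b hb _ => by
      have := (Prog.runs_push k true s).seq (Prog.runs_pop k _)
      simp only [update_idem, update_self, List.tail_cons, Polynomial.eval_ofNat] at this ⊢
      rwa [hb] at this
  exact h.headD.congr fun a => by cases f a <;> simp [List.replicate_succ]

theorem PolyTime.add {f g : α → ℕ} (hf : PolyTime f) (hg : PolyTime g) :
    PolyTime fun a => f a + g a := by
  have h : ∀ a i, _root_.iter (f a) (fun _ b => b + 1) i = f a + i := fun a i => by
    induction i with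
    | zero => rfl
    | succ i ih => rw [_root_.iter, ih]; rfl
  obtain ⟨F, hF⟩ := hf.length_le
  obtain ⟨G, hG⟩ := hg.length_le
  simp only [length_enc_nat] at hF hG
  refine (PolyTime.iterate (g := fun q : (α × ℕ) × ℕ => q.1.2 + 1) hg hf polyTime_snd.fst.succ
    (F + G) fun a i hi => ?_).congr fun a => h a _
  rw [h, length_enc_nat, Polynomial.eval_add]
  have := hF a
  have := hG a
  omega

theorem PolyTime.sub {f g : α → ℕ} (hf : PolyTime f) (hg : PolyTime g) :
    PolyTime fun a => f a - g a := by
  have h : ∀ a i, _root_.iter (f a) (fun _ b => b - 1) i = f a - i := fun a i => by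
    induction i with
    | zero => rfl
    | succ i ih => rw [_root_.iter, ih]; rfl
  obtain ⟨F, hF⟩ := hf.length_le
  simp only [length_enc_nat] at hF
  refine (PolyTime.iterate (g := fun q : (α × ℕ) × ℕ => q.1.2 - 1) hg hf polyTime_snd.fst.pred
    F fun a i hi => ?_).congr fun a => h a _
  rw [h, length_enc_nat]
  exact (Nat.sub_le _ _).trans (hF a)

theorem PolyTime.mul {f g : α → ℕ} (hf : PolyTime f) (hg : PolyTime g) :
    PolyTime fun a => f a * g a := by
  have h : ∀ a i, _root_.iter 0 (fun _ b => b + f a) i = f a * i := fun a i => by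
    induction i with
    | zero => rfl
    | succ i ih => rw [_root_.iter, ih]; rfl
  obtain ⟨F, hF⟩ := hf.length_le
  obtain ⟨G, hG⟩ := hg.length_le
  simp only [length_enc_nat] at hF hG
  refine (PolyTime.iterate (g := fun q : (α × ℕ) × ℕ => q.1.2 + f q.1.1) hg (polyTime_const 0)
    (polyTime_snd.fst.add hf.fst.fst) (F * G) fun a i hi => ?_).congr fun a => h a _
  rw [h, length_enc_nat, Polynomial.eval_mul]
  exact Nat.mul_le_mul (hF a) (hi.trans (hG a))

theorem PolyTime.le {f g : α → ℕ} (hf : PolyTime f) (hg : PolyTime g) :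
    PolyTime fun a => decide (f a ≤ g a) :=
  (hf.sub hg).ne_zero.not.congr fun a => by
    rw [← decide_not]
    exact decide_eq_decide.2 (not_not.trans Nat.sub_eq_zero_iff_le)

theorem PolyTime.lt {f g : α → ℕ} (hf : PolyTime f) (hg : PolyTime g) :
    PolyTime fun a => decide (f a < g a) :=
  hf.succ.le hg

theorem PolyTime.eq {f g : α → ℕ} (hf : PolyTime f) (hg : PolyTime g) :
    PolyTime fun a => decide (f a = g a) :=
  ((hf.le hg).and (hg.le hf)).congr fun a => by
    rw [← Bool.decide_and]
    exact decide_eq_decide.2 le_antisymm_iff.symm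

/-! #### Bounded quantifiers -/

theorem PolyTime.any {n : α → ℕ} {f : α → ℕ → Bool} (hn : PolyTime n)
    (hf : PolyTime fun q : α × ℕ => f q.1 q.2) :
    PolyTime fun a => (List.range (n a)).any fun i => f a i := by
  refine (PolyTime.iterate (g := fun q : (α × Bool) × ℕ => q.1.2 || f q.1.1 q.2) hn
    (polyTime_const false) (polyTime_snd.fst.or hf.skip) 1 fun a i _ => ?_).congr fun a => ?_
  · simp [enc]
  · generalize n a = m
    induction m with
    | zero => rfl
    | succ m ih => rw [_root_.iter, ih]; simp [List.range_succ]

theorem PolyTime.all {n : α → ℕ} {f : α → ℕ → Bool} (hn : PolyTime n)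
    (hf : PolyTime fun q : α × ℕ => f q.1 q.2) :
    PolyTime fun a => (List.range (n a)).all fun i => f a i :=
  (hn.any (f := fun a i => !f a i) hf.not).not.congr fun a => by simp [List.all_eq_not_any_not]

theorem PolyTime.countP {n : α → ℕ} {f : α → ℕ → Bool} (hn : PolyTime n)
    (hf : PolyTime fun q : α × ℕ => f q.1 q.2) :
    PolyTime fun a => (List.range (n a)).countP fun i => f a i := by
  have h : ∀ a i, _root_.iter 0 (fun i b => if f a i then b + 1 else b) i
      = (List.range i).countP fun i => f a i := fun a i => by
    induction i with
    | zero => rfl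
    | succ i ih =>
      rw [_root_.iter, ih, List.range_succ, List.countP_append]
      cases h : f a i <;> simp [h]
  obtain ⟨N, hN⟩ := hn.length_le
  simp only [length_enc_nat] at hN
  refine (PolyTime.iterate (g := fun q : (α × ℕ) × ℕ => if f q.1.1 q.2 then q.1.2 + 1 else q.1.2)
    hn (polyTime_const 0) (hf.skip.ite polyTime_snd.fst.succ polyTime_snd.fst) N
    fun a i hi => ?_).congr fun a => h a _
  rw [h, length_enc_nat]
  exact List.countP_le_length.trans (by simpa using hi.trans (hN a))

/-- Tabulation of a Boolean function. -/
theorem PolyTime.table {n : α → ℕ} {f : α → ℕ → Bool} (hn : PolyTime n)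
    (hf : PolyTime fun q : α × ℕ => f q.1 q.2) :
    PolyTime fun a => (List.range (n a)).map fun i => f a i := by
  have h : ∀ a i, _root_.iter [] (fun i l => f a i :: l) i
      = ((List.range i).map fun i => f a i).reverse := fun a i => by
    induction i with
    | zero => rfl
    | succ i ih => rw [_root_.iter, ih, List.range_succ]; simp
  obtain ⟨N, hN⟩ := hn.length_le
  simp only [length_enc_nat] at hN
  refine (PolyTime.iterate (g := fun q : (α × List Bool) × ℕ => f q.1.1 q.2 :: q.1.2)
    hn (polyTime_const []) (hf.skip.cons polyTime_snd.fst) N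
    fun a i hi => ?_).reverse.congr fun a => by simp [h]
  rw [h]
  simpa [enc] using hi.trans (hN a)

theorem PolyTime.drop {f : α → List Bool} {n : α → ℕ} (hf : PolyTime f) (hn : PolyTime n) :
    PolyTime fun a => (f a).drop (n a) := by
  have h : ∀ a i, _root_.iter (f a) (fun _ l => l.tail) i = (f a).drop i := fun a i => by
    induction i with
    | zero => rfl
    | succ i ih => rw [_root_.iter, ih, List.tail_drop]
  obtain ⟨F, hF⟩ := hf.length_le
  refine (PolyTime.iterate (g := fun q : (α × List Bool) × ℕ => q.1.2.tail)
    hn hf polyTime_snd.fst.tail F fun a i hi => ?_).congr fun a => h a _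
  rw [h]
  exact le_trans (by simp [enc]) (hF a)

theorem PolyTime.getD {f : α → List Bool} {n : α → ℕ} (hf : PolyTime f) (hn : PolyTime n) :
    PolyTime fun a => (f a).getD (n a) false :=
  (hf.drop hn).headD.congr fun a => by
    rw [List.headD_eq_head?_getD, List.head?_drop, List.getD_eq_getElem?_getD]

end

/-! ### Choice of neighbours without backtracking -/

namespace SimpleGraph

variable {V : Type*} {G : SimpleGraph V}

/-- A vertex has a neighbour closer to a given other vertex of its component. -/
theorem Reachable.exists_adj_dist_lt {x r : V} (h : G.Reachable x r) (hx : x ≠ r) :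
    ∃ y, G.Adj x y ∧ G.dist y r < G.dist x r := by
  obtain ⟨p, hp⟩ := h.exists_walk_length_eq_dist
  cases p with
  | nil => exact absurd rfl hx
  | cons h q =>
    refine ⟨_, h, (dist_le q).trans_lt ?_⟩
    rw [← hp, Walk.length_cons]
    exact Nat.lt_succ_self _

/-- Deleting an edge whose ends stay connected does not affect connectivity. -/
theorem Reachable.deleteEdges_singleton {a b : V}
    (hab : (G.deleteEdges {s(a, b)}).Reachable b a) {x y : V} (h : G.Reachable x y) :
    (G.deleteEdges {s(a, b)}).Reachable x y := by
  obtain ⟨p⟩ := h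
  induction p with
  | nil => exact Reachable.refl _
  | cons h _ ih =>
    rename_i u v w _
    refine Reachable.trans ?_ ih
    by_cases he : s(u, v) = s(a, b)
    · rcases Sym2.eq_iff.1 he with ⟨rfl, rfl⟩ | ⟨rfl, rfl⟩
      exacts [hab.symm, hab]
    · exact Adj.reachable (by simpa [deleteEdges_adj] using ⟨h, by simpa using he⟩)

/-- Following a choice of neighbours without ever backtracking leads to a cycle. -/
theorem exists_adj_reachable_of_iterate [Finite V] {f : V → V} {x : V}
    (hadj : ∀ i, G.Adj (f^[i] x) (f^[i + 1] x)) (hback : ∀ i, f^[i + 2] x ≠ f^[i] x) :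
    ∃ r b, G.Reachable x r ∧ G.Adj r b ∧ (G.deleteEdges {s(r, b)}).Reachable b r := by
  have hreach : ∀ i, G.Reachable x (f^[i] x) := fun i => by
    induction i with
    | zero => exact Reachable.refl _
    | succ i ih => exact ih.trans (hadj i).reachable
  -- By finiteness the orbit repeats. The period `k` is then taken minimal over all starting points
  -- `i`, which makes the vertices of one period distinct.
  have hper : ∃ k > 0, ∃ i, f^[i + k] x = f^[i] x := by
    obtain ⟨i, j, hij, h⟩ := Finite.exists_ne_map_eq_of_infinite fun i : ℕ => f^[i] x
    rcases lt_or_gt_of_ne hij with hij | hij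
    · exact ⟨j - i, by omega, i, by rw [Nat.add_sub_cancel' hij.le]; exact h.symm⟩
    · exact ⟨i - j, by omega, j, by rw [Nat.add_sub_cancel' hij.le]; exact h⟩
  classical
  obtain ⟨hk, i, hi⟩ := Nat.find_spec hper
  set k := Nat.find hper with hkdef
  have hmin : ∀ j l, f^[j + l] x = f^[j] x → 0 < l → k ≤ l := fun j l h hl =>
    Nat.find_min' hper ⟨hl, j, h⟩
  have hinj : ∀ j l, j < k → l < k → f^[i + j] x = f^[i + l] x → j = l := by
    intro j l hj hl h
    rcases lt_trichotomy j l with hjl | hjl | hjl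
    · have := hmin (i + j) (l - j) (by rw [h, show i + j + (l - j) = i + l by omega])
        (by omega)
      omega
    · exact hjl
    · have := hmin (i + l) (j - l) (by rw [← h, show i + l + (j - l) = i + j by omega])
        (by omega)
      omega
  -- Period one would be a loop and period two a backtracking step.
  have hk₁ : k ≠ 1 := fun h => (hadj i).ne (by rw [← hi, h])
  have hk₂ : k ≠ 2 := fun h => hback i (by rw [← hi, h])
  refine ⟨f^[i] x, f^[i + 1] x, hreach i, hadj i, ?_⟩
  -- The rest of the closed walk avoids its first edge: by distinctness the edge could recur only in
  -- reverse at `j = 1`, which would be backtracking.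
  have hstep : ∀ j, 1 ≤ j → j < k →
      (G.deleteEdges {s(f^[i] x, f^[i + 1] x)}).Adj (f^[i + j] x) (f^[i + j + 1] x) := by
    intro j hj hjk
    rw [deleteEdges_adj]
    refine ⟨hadj _, fun h => ?_⟩
    rcases Sym2.eq_iff.1 h with ⟨h₁, _⟩ | ⟨h₁, h₂⟩
    · have := hinj j 0 hjk (by omega) h₁
      omega
    · have := hinj j 1 hjk (by omega) h₁
      subst this
      exact hback i h₂
  have hwalk : ∀ j, 1 ≤ j → j ≤ k →
      (G.deleteEdges {s(f^[i] x, f^[i + 1] x)}).Reachable (f^[i + 1] x) (f^[i + j] x) := by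
    intro j hj
    induction j, hj using Nat.le_induction with
    | base => exact fun _ => Reachable.refl _
    | succ j hj ih => exact fun hjk => (ih (by omega)).trans (hstep j hj (by omega)).reachable
  have := hwalk k (by omega) le_rfl
  rwa [hi] at this

/-- Every vertex outside `R` can choose a neighbour such that no two vertices outside `R` choose
each other if and only if every component contains a vertex of `R` or a cycle. -/
theorem exists_choice_iff [Finite V] (R : V → Prop) :
    (∃ f : V → V, ∀ x, ¬R x → G.Adj x (f x) ∧ (¬R (f x) → f (f x) ≠ x)) ↔
      ∀ x, ∃ r, G.Reachable x r ∧
        (R r ∨ ∃ b, G.Adj r b ∧ (G.deleteEdges {s(r, b)}).Reachable b r) := by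
  constructor
  · rintro ⟨f, hf⟩ x
    by_cases h : ∃ r, G.Reachable x r ∧ R r
    · obtain ⟨r, hr, hR⟩ := h
      exact ⟨r, hr, Or.inl hR⟩
    · push Not at h
      have hreach : ∀ i, G.Reachable x (f^[i] x) := fun i => by
        induction i with
        | zero => exact Reachable.refl _
        | succ i ih =>
          rw [Function.iterate_succ_apply']
          exact ih.trans (hf _ (h _ ih)).1.reachable
      have hR : ∀ i, ¬R (f^[i] x) := fun i => h _ (hreach i)
      obtain ⟨r, b, hr, hb, hc⟩ := exists_adj_reachable_of_iterate (G := G) (f := f) (x := x)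
        (fun i => by rw [Function.iterate_succ_apply']; exact (hf _ (hR i)).1)
        (fun i => by
          have := hR (i + 1)
          rw [Function.iterate_succ_apply'] at this
          rw [Function.iterate_succ_apply', Function.iterate_succ_apply']
          exact (hf _ (hR i)).2 this)
      exact ⟨r, hr, Or.inr ⟨b, hb, hc⟩⟩
  · intro h
    -- Choices stay inside a component, so they can be made for each component separately and glued.
    have key : ∀ C : G.ConnectedComponent, ∃ f : V → V, ∀ x, G.connectedComponentMk x = C → ¬R x →
        G.Adj x (f x) ∧ (¬R (f x) → f (f x) ≠ x) := by
      intro C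
      induction C using ConnectedComponent.ind with
      | h v =>
      obtain ⟨r, hr, hR | ⟨b, hb, hc⟩⟩ := h v
      -- Every vertex except `r` steps strictly closer to `r`, which excludes mutual choices; `r` is
      -- in `R` and need not choose.
      · have : ∀ x, ∃ y, G.Reachable x r → x ≠ r → G.Adj x y ∧ G.dist y r < G.dist x r := by
          intro x
          by_cases hx : G.Reachable x r ∧ x ≠ r
          · obtain ⟨y, hy⟩ := hx.1.exists_adj_dist_lt hx.2
            exact ⟨y, fun _ _ => hy⟩
          · exact ⟨x, fun h₁ h₂ => absurd ⟨h₁, h₂⟩ hx⟩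
        choose f hf using this
        refine ⟨f, fun x hx hRx => ?_⟩
        have hxr : G.Reachable x r := (ConnectedComponent.eq.1 hx).trans hr
        have h₁ := hf x hxr (by rintro rfl; exact hRx hR)
        refine ⟨h₁.1, fun hRf he => ?_⟩
        have h₂ := hf (f x) (h₁.1.symm.reachable.trans hxr) (by rintro h; rw [h] at hRf; exact hRf hR)
        rw [he] at h₂
        omega
      -- The component stays connected without the edge from `r` to `b`. Let `r` choose `b` and
      -- every other vertex step closer to `r` in `G'`; then `b` cannot choose `r`, the edge between
      -- them being absent there.
      · set G' := G.deleteEdges {s(r, b)} with hG'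
        have hle : ∀ {x y}, G'.Adj x y → G.Adj x y := fun h => (deleteEdges_adj.1 h).1
        have : ∀ x, ∃ y, (x = r → y = b) ∧
            (G'.Reachable x r → x ≠ r → G'.Adj x y ∧ G'.dist y r < G'.dist x r) := by
          intro x
          by_cases hx : x = r
          · exact ⟨b, fun _ => rfl, fun _ h => absurd hx h⟩
          by_cases hx' : G'.Reachable x r
          · obtain ⟨y, hy⟩ := hx'.exists_adj_dist_lt hx
            exact ⟨y, fun h => absurd h hx, fun _ _ => hy⟩
          · exact ⟨x, fun h => absurd h hx, fun h => absurd h hx'⟩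
        choose f hfr hf using this
        refine ⟨f, fun x hx _ => ?_⟩
        have hxr : G'.Reachable x r :=
          Reachable.deleteEdges_singleton hc ((ConnectedComponent.eq.1 hx).trans hr)
        have hbr : ∀ y, G'.Adj y r → y ≠ b := by
          rintro y hy rfl
          exact (deleteEdges_adj.1 hy).2 (by simp [Sym2.eq_swap])
        by_cases hxe : x = r
        · subst hxe
          rw [hfr x rfl]
          refine ⟨hb, fun _ he => ?_⟩
          have := (hf b hc hb.ne').1
          rw [he] at this
          exact hbr b this rfl
        · have h₁ := hf x hxr hxe
          refine ⟨hle h₁.1, fun _ he => ?_⟩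
          by_cases hfe : f x = r
          · rw [hfe, hfr r rfl] at he
            rw [hfe] at h₁
            exact hbr x h₁.1 he.symm
          · have h₂ := hf (f x) (h₁.1.symm.reachable.trans hxr) hfe
            rw [he] at h₂
            omega
    choose f hf using key
    refine ⟨fun x => f (G.connectedComponentMk x) x, fun x hx => ?_⟩
    have h₁ := hf _ x rfl hx
    refine ⟨h₁.1, fun hR => ?_⟩
    have : G.connectedComponentMk (f (G.connectedComponentMk x) x) = G.connectedComponentMk x :=
      ConnectedComponent.eq.2 h₁.1.symm.reachable
    simp only [this]
    exact h₁.2 hR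

end SimpleGraph

/-! ### Maximin possible winners when votes have at most one undetermined pair -/

namespace PartialVote

variable {C : Type}

/-- The candidates `x` and `y` form an undetermined pair of the partial vote `p`. -/
def Und (p : PartialVote C) (x y : C) : Prop :=
  p.pref x y = false ∧ p.pref y x = false

instance (p : PartialVote C) (x y : C) : Decidable (p.Und x y) :=
  inferInstanceAs (Decidable (_ ∧ _))

theorem Und.symm {p : PartialVote C} {x y : C} (h : p.Und x y) : p.Und y x := ⟨h.2, h.1⟩

theorem Und.ne {p : PartialVote C} {x y : C} (h : p.Und x y) : x ≠ y := by
  rintro rfl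
  simpa [p.refl] using h.1

theorem mem_undeterminedPairs [Fintype C] [DecidableEq C] {p : PartialVote C} {s : Finset C} :
    s ∈ p.undeterminedPairs ↔ ∃ x y, p.Und x y ∧ s = {x, y} := by
  simp only [undeterminedPairs, Finset.mem_filter, Finset.mem_powersetCard_univ,
    Finset.card_eq_two]
  constructor
  · rintro ⟨⟨x, y, hxy, rfl⟩, h⟩
    exact ⟨x, y, ⟨h x (by simp) y (by simp) hxy, h y (by simp) x (by simp) hxy.symm⟩, rfl⟩
  · rintro ⟨x, y, h, rfl⟩
    refine ⟨⟨x, y, h.ne, rfl⟩, ?_⟩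
    intro u hu v hv huv
    simp only [Finset.mem_insert, Finset.mem_singleton] at hu hv
    rcases hu with rfl | rfl <;> rcases hv with rfl | rfl
    exacts [absurd rfl huv, h.1, h.2, absurd rfl huv]

/-- This elementwise form is the hypothesis `hP` of the later results, and it is what
`VoteCode.almostDetermined` tests. -/
theorem card_undeterminedPairs_le_one [Fintype C] [DecidableEq C] {p : PartialVote C} :
    p.undeterminedPairs.card ≤ 1 ↔
      ∀ x y u v, p.Und x y → p.Und u v → (x = u ∧ y = v) ∨ (x = v ∧ y = u) := by
  rw [Finset.card_le_one]
  constructor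
  · intro h x y u v hxy huv
    have := h _ (mem_undeterminedPairs.2 ⟨x, y, hxy, rfl⟩) _ (mem_undeterminedPairs.2 ⟨u, v, huv, rfl⟩)
    rwa [← Finset.coe_inj, Finset.coe_pair, Finset.coe_pair, Set.pair_eq_pair_iff] at this
  · intro h s hs t ht
    obtain ⟨x, y, hxy, rfl⟩ := mem_undeterminedPairs.1 hs
    obtain ⟨u, v, huv, rfl⟩ := mem_undeterminedPairs.1 ht
    rcases h x y u v hxy huv with ⟨rfl, rfl⟩ | ⟨rfl, rfl⟩
    exacts [rfl, Finset.pair_comm _ _]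

/-- The completion of a partial vote with at most one undetermined pair by a choice of the order
of this pair. -/
def complete [DecidableEq C] (p : PartialVote C)
    (hp : ∀ x y u v, p.Und x y → p.Und u v → (x = u ∧ y = v) ∨ (x = v ∧ y = u))
    (o : C → C → Prop) [DecidableRel o] (ho : ∀ x y, x ≠ y → (o x y ↔ ¬o y x)) : CompleteVote C where
  pref x y := p.pref x y || decide (p.Und x y ∧ o x y)
  refl x := by simp [p.refl]
  antisymm x y hxy hyx := by
    simp only [Bool.or_eq_true, decide_eq_true_eq] at hxy hyx
    rcases hxy with hxy | ⟨hu, hxy⟩ <;> rcases hyx with hyx | ⟨hu', hyx⟩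
    · exact p.antisymm x y hxy hyx
    · simp [hu'.2] at hxy
    · simp [hu.2] at hyx
    · exact absurd hyx ((ho x y hu.ne).1 hxy)
  trans x y z hxy hyz := by
    simp only [Bool.or_eq_true, decide_eq_true_eq] at hxy hyz ⊢
    rcases hxy with hxy | ⟨hu, hxy⟩ <;> rcases hyz with hyz | ⟨hu', hyz⟩
    · exact Or.inl (p.trans x y z hxy hyz)
    -- If `x` is not firmly before `z`, then the pair of `x` and `z` is undetermined too, since `z`
    -- before `x` would put `z` before `y`. It is therefore the pair of `y` and `z`, and `x = y`.
    -- The next case is symmetric.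
    · by_cases h : p.pref x z = true
      · exact Or.inl h
      · have hzx : p.pref z x = false := Bool.eq_false_iff.2 fun h' => by
          have := p.trans z x y h' hxy
          simp [hu'.2] at this
        rcases hp x z y z ⟨by simpa using h, hzx⟩ hu' with ⟨rfl, _⟩ | ⟨rfl, rfl⟩
        · exact Or.inr ⟨hu', hyz⟩
        · exact absurd (p.refl _) h
    · by_cases h : p.pref x z = true
      · exact Or.inl h
      · have hzx : p.pref z x = false := Bool.eq_false_iff.2 fun h' => by
          have := p.trans y z x hyz h'
          simp [hu.2] at this
        rcases hp x z x y ⟨by simpa using h, hzx⟩ hu with ⟨_, rfl⟩ | ⟨rfl, _⟩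
        · exact Or.inr ⟨hu, hxy⟩
        · exact absurd rfl hu.ne
    · rcases hp x y y z hu hu' with ⟨h, _⟩ | ⟨rfl, _⟩
      · exact absurd h hu.ne
      · exact Or.inl (p.refl _)
  total x y := by
    simp only [Bool.or_eq_true, decide_eq_true_eq]
    by_cases hxy : p.pref x y = true
    · exact Or.inl (Or.inl hxy)
    by_cases hyx : p.pref y x = true
    · exact Or.inr (Or.inl hyx)
    have hu : p.Und x y := ⟨by simpa using hxy, by simpa using hyx⟩
    by_cases h : o x y
    · exact Or.inl (Or.inr ⟨hu, h⟩)
    · exact Or.inr (Or.inr ⟨hu.symm, (ho y x hu.ne.symm).2 h⟩)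

end PartialVote

/-! ### Attainable margins and the reduction to choices of rivals -/

section Profile

variable {C : Type} {n : ℕ} (P : Fin n → PartialVote C)

/-- The number of partial votes that place `x` before `y`. -/
def firmCount (x y : C) : ℕ := (Finset.univ.filter fun i => (P i).pref x y = true).card

/-- The number of partial votes in which the pair of `x` and `y` is undetermined. -/
def openCount (x y : C) : ℕ := (Finset.univ.filter fun i => (P i).Und x y).card

/-- The least possible margin of `x` from `y`. -/
def lowMargin (x y : C) : ℤ := firmCount P x y - firmCount P y x - openCount P x y

/-- The largest possible margin of `x` from `y`. -/
def highMargin (x y : C) : ℤ := firmCount P x y - firmCount P y x + openCount P x y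

/-- The number of voters with undetermined pair `x`, `y` that place `x` before `y` in a profile of
complete votes. -/
def wonCount [DecidableEq C] (V : Fin n → CompleteVote C) (x y : C) : ℕ :=
  (Finset.univ.filter fun i => (P i).Und x y ∧ (V i).Before x y).card

variable {P}

theorem openCount_comm (x y : C) : openCount P x y = openCount P y x := by
  rw [openCount, openCount]
  congr 1
  ext i
  simp only [Finset.mem_filter, Finset.mem_univ, true_and]
  exact ⟨fun h => h.symm, fun h => h.symm⟩

theorem CompleteVote.before_iff_not [DecidableEq C] (v : CompleteVote C) {x y : C} (h : x ≠ y) :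
    v.Before x y ↔ ¬v.Before y x := by
  constructor
  · exact fun h₁ h₂ => h (v.antisymm x y h₁.1 h₂.1)
  · intro h₁
    refine ⟨?_, h⟩
    rcases v.total x y with h₂ | h₂
    · exact h₂
    · exact absurd ⟨h₂, h.symm⟩ h₁

variable [DecidableEq C] {V : Fin n → CompleteVote C}

theorem wonCount_add (x y : C) (h : x ≠ y) :
    wonCount P V x y + wonCount P V y x = openCount P x y := by
  rw [wonCount, wonCount, openCount, ← Finset.card_union_of_disjoint]
  · congr 1
    ext i
    simp only [Finset.mem_union, Finset.mem_filter, Finset.mem_univ, true_and]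
    constructor
    · rintro (h | h)
      exacts [h.1, h.1.symm]
    · intro hu
      by_cases hb : (V i).Before x y
      · exact Or.inl ⟨hu, hb⟩
      · exact Or.inr ⟨hu.symm, ((V i).before_iff_not h.symm).2 hb⟩
  · rw [Finset.disjoint_filter]
    exact fun i _ h₁ h₂ => ((V i).before_iff_not h).1 h₁.2 h₂.2

theorem card_before (hV : ∀ i, (V i).Extends (P i)) (x y : C) (h : x ≠ y) :
    (Finset.univ.filter fun i => (V i).Before x y).card = firmCount P x y + wonCount P V x y := by
  rw [firmCount, wonCount, ← Finset.card_union_of_disjoint]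
  · congr 1
    ext i
    simp only [Finset.mem_union, Finset.mem_filter, Finset.mem_univ, true_and]
    constructor
    · intro hb
      by_cases hf : (P i).pref x y = true
      · exact Or.inl hf
      · refine Or.inr ⟨⟨by simpa using hf, Bool.eq_false_iff.2 fun hf' => ?_⟩, hb⟩
        exact ((V i).before_iff_not h).1 hb ⟨hV i _ _ hf', h.symm⟩
    · rintro (hf | hf)
      exacts [⟨hV i _ _ hf, h⟩, hf.2]
  · rw [Finset.disjoint_filter]
    intro i _ h₁ h₂
    simp [h₂.1.1] at h₁

/-- In `lowMargin` every open vote counts `-1`; each one that goes to `x` instead counts `+1`, a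
gain of two. -/
theorem margin_eq (hV : ∀ i, (V i).Extends (P i)) (x y : C) (h : x ≠ y) :
    margin V x y = lowMargin P x y + 2 * wonCount P V x y := by
  rw [margin, card_before hV x y h, card_before hV y x h.symm, lowMargin, ← wonCount_add (V := V) x y h]
  push_cast
  ring

theorem margin_swap (x y : C) : margin V y x = -margin V x y := by
  rw [margin, margin]
  ring

/-- Extensions of the profile can split the undetermined pairs in any prescribed ratio. -/
theorem exists_extension_wonCount
    (hP : ∀ i x y u v, (P i).Und x y → (P i).Und u v → (x = u ∧ y = v) ∨ (x = v ∧ y = u))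
    (k : C → C → ℕ) (hk : ∀ x y, x ≠ y → k x y + k y x = openCount P x y) :
    ∃ V : Fin n → CompleteVote C, (∀ i, (V i).Extends (P i)) ∧
      ∀ x y, x ≠ y → wonCount P V x y = k x y := by
  classical
  have hT : ∀ x y, ∃ T : Finset (Fin n),
      T ⊆ (Finset.univ.filter fun i => (P i).Und x y) ∧ (x ≠ y → T.card = k x y) := by
    intro x y
    by_cases h : x = y
    · exact ⟨∅, by simp, fun h' => absurd h h'⟩
    · obtain ⟨T, h₁, h₂⟩ := Finset.exists_subset_card_eq
        (s := Finset.univ.filter fun i => (P i).Und x y) (n := k x y)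
        (by have := hk x y h; rw [openCount] at this; omega)
      exact ⟨T, h₁, fun _ => h₂⟩
  choose T hTsub hTcard using hT
  -- An arbitrary order of the candidates picks one orientation of each pair: for `x < y` the voters
  -- in `T x y` put `x` first, and the others with this pair open put `y` first.
  let _ : LinearOrder C := WellOrderingRel.isWellOrder.linearOrder
  let o : Fin n → C → C → Prop := fun i x y => if x < y then i ∈ T x y else i ∉ T y x
  have ho : ∀ i x y, x ≠ y → (o i x y ↔ ¬o i y x) := by
    intro i x y h
    rcases lt_or_gt_of_ne h with h | h
    · simp [o, h, h.not_gt]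
    · simp [o, h, h.not_gt]
  let V : Fin n → CompleteVote C := fun i => (P i).complete (hP i) (o i) (ho i)
  have hV : ∀ i, (V i).Extends (P i) := fun i x y h => by
    change ((P i).pref x y || _) = true
    rw [h, Bool.true_or]
  refine ⟨V, hV, ?_⟩
  have hb : ∀ i x y, (P i).Und x y → ((V i).Before x y ↔ o i x y) := by
    intro i x y hu
    change ((P i).pref x y || decide ((P i).Und x y ∧ o i x y)) = true ∧ x ≠ y ↔ o i x y
    simp [hu.1, hu, hu.ne]
  have hlt : ∀ x y, x < y → wonCount P V x y = k x y := by
    intro x y h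
    rw [← hTcard x y h.ne, wonCount]
    congr 1
    ext i
    simp only [Finset.mem_filter, Finset.mem_univ, true_and]
    constructor
    · rintro ⟨hu, h'⟩
      simpa [o, h] using (hb i x y hu).1 h'
    · intro hi
      have hu : (P i).Und x y := by simpa using hTsub x y hi
      exact ⟨hu, (hb i x y hu).2 (by simpa [o, h] using hi)⟩
  intro x y h
  rcases lt_or_gt_of_ne h with h' | h'
  · exact hlt x y h'
  · have h₁ := hlt y x h'
    have h₂ := wonCount_add (P := P) (V := V) x y h
    have h₃ := hk x y h
    omega

/-- The candidate `x` can be made to lose to `y` by so much that it does not beat `c`. -/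
def CanLose (P : Fin n → PartialVote C) (c x y : C) : Prop :=
  ∀ z, z ≠ c → lowMargin P x y ≤ highMargin P c z

/-- The margins between `x` and `y` can be such that neither of them beats `c`. -/
def CanTie (P : Fin n → PartialVote C) (c x y : C) : Prop :=
  ∃ j ≤ openCount P x y, ∀ z, z ≠ c → lowMargin P x y + 2 * j ≤ highMargin P c z ∧
    -(lowMargin P x y + 2 * j) ≤ highMargin P c z

-- Replacing `j` by `openCount P x y - j` negates the margin, and the condition is symmetric under
-- negation.
omit [DecidableEq C] in
theorem CanTie.symm {c x y : C} (h : CanTie P c x y) : CanTie P c y x := by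
  obtain ⟨j, hj, h⟩ := h
  have hc := openCount_comm (P := P) x y
  refine ⟨openCount P x y - j, by omega, fun z hz => ?_⟩
  have := h z hz
  rw [lowMargin] at this ⊢
  rw [← hc]
  push_cast [hj]
  constructor <;> linarith

/-- The value `f x` is a rival that keeps the score of `x` at or below that of `c`. Different pairs
of candidates are settled independently, so beyond the single demands `CanLose` only mutual choices
impose a joint condition. -/
theorem maximin_possible_iff [Fintype C]
    (hP : ∀ i x y u v, (P i).Und x y → (P i).Und u v → (x = u ∧ y = v) ∨ (x = v ∧ y = u)) (c : C) :
    (∃ V : Fin n → CompleteVote C, (∀ i, (V i).Extends (P i)) ∧ c ∈ maximinWinners V) ↔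
      ∃ f : C → C, ∀ x, x ≠ c → f x ≠ x ∧ CanLose P c x (f x) ∧
        (f x ≠ c → f (f x) = x → CanTie P c x (f x)) := by
  constructor
  · rintro ⟨V, hV, hc⟩
    have hhigh : ∀ z, z ≠ c → margin V c z ≤ highMargin P c z := by
      intro z hz
      have h₁ := wonCount_add (P := P) (V := V) c z hz.symm
      rw [margin_eq hV c z hz.symm, lowMargin, highMargin]
      omega
    have : ∀ x, ∃ y, x ≠ c → y ≠ x ∧ ∀ z, z ≠ c → margin V x y ≤ highMargin P c z := by
      intro x
      by_cases hx : x = c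
      · exact ⟨x, fun h => absurd hx h⟩
      -- The rival of `x` is an opponent at which its score is attained.
      obtain ⟨y, hy, hys⟩ := Finset.exists_mem_eq_inf (Finset.univ.erase x) ⟨c, by simp [Ne.symm hx]⟩
        fun y => (margin V x y : WithTop ℤ)
      refine ⟨y, fun _ => ⟨(Finset.mem_erase.1 hy).1, fun z hz => le_trans ?_ (hhigh z hz)⟩⟩
      have h₁ : maximinScore V x ≤ maximinScore V c := hc x
      have h₂ : maximinScore V c ≤ margin V c z := Finset.inf_le (by simp [hz])
      rw [maximinScore, hys] at h₁
      exact WithTop.coe_le_coe.1 (h₁.trans h₂)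
    choose f hf using this
    refine ⟨f, fun x hx => ⟨(hf x hx).1, fun z hz => ?_, fun hfx hff => ?_⟩⟩
    · have := (hf x hx).2 z hz
      rw [margin_eq hV _ _ (hf x hx).1.symm] at this
      omega
    · refine ⟨wonCount P V x (f x), ?_, fun z hz => ?_⟩
      · have := wonCount_add (P := P) (V := V) x (f x) (hf x hx).1.symm
        omega
      · have h₁ := (hf x hx).2 z hz
        have h₂ := (hf (f x) hfx).2 z hz
        rw [hff, margin_swap] at h₂
        rw [← margin_eq hV _ _ (hf x hx).1.symm]
        exact ⟨h₁, h₂⟩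
  · rintro ⟨f, hf⟩
    -- The demands of `x` on the number `a` of open votes it wins against `y`: `c` must win all of
    -- them, and `x` must win few enough against its chosen rival. Winning none suits every `x ≠ c`;
    -- winning all suits everyone who has not chosen `y`.
    let R : C → C → ℕ → Prop := fun x y a => (x = c → a = openCount P x y) ∧
      (x ≠ c → f x = y → ∀ z, z ≠ c → lowMargin P x y + 2 * a ≤ highMargin P c z)
    have hzero : ∀ x y, x ≠ c → R x y 0 := fun x y hx =>
      ⟨fun h => absurd h hx, fun _ h z hz => by
        subst h
        simpa using (hf x hx).2.1 z hz⟩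
    have hall : ∀ x y, (x ≠ c → f x ≠ y) → R x y (openCount P x y) := fun x y h =>
      ⟨fun _ => rfl, fun hx hy => absurd hy (h hx)⟩
    have : ∀ x y, ∃ a b, x ≠ y → a + b = openCount P x y ∧ R x y a ∧ R y x b := by
      intro x y
      have hco := openCount_comm (P := P) x y
      by_cases hx : x = c
      · refine ⟨openCount P x y, 0, fun hxy => ⟨rfl, hall x y fun h => absurd hx h, ?_⟩⟩
        exact hzero y x fun h => hxy (hx.trans h.symm)
      by_cases hy : y = c
      · exact ⟨0, openCount P y x, fun _ => ⟨by omega, hzero x y hx, hall y x fun h => absurd hy h⟩⟩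
      by_cases hfx : f x = y
      · by_cases hfy : f y = x
        -- Only a mutual choice makes two upper bounds compete for one pair; `CanTie` supplies the
        -- split.
        · subst hfx
          obtain ⟨j, hj, hjt⟩ := (hf x hx).2.2 hy hfy
          refine ⟨j, openCount P x (f x) - j, fun _ => ⟨by omega, ⟨fun h => absurd h hx,
            fun _ _ z hz => (hjt z hz).1⟩, ⟨fun h => absurd h hy, fun _ _ z hz => ?_⟩⟩⟩
          have := (hjt z hz).2
          rw [lowMargin] at this ⊢
          push_cast [hj]
          linarith
        · exact ⟨0, openCount P y x, fun _ => ⟨by omega, hzero x y hx, hall y x fun _ => hfy⟩⟩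
      · exact ⟨openCount P x y, 0, fun _ => ⟨rfl, hall x y fun _ => hfx, hzero y x hy⟩⟩
    choose a b hab using this
    let _ : LinearOrder C := WellOrderingRel.isWellOrder.linearOrder
    let k : C → C → ℕ := fun x y => if x < y then a x y else b y x
    have hk : ∀ x y, x ≠ y → k x y + k y x = openCount P x y ∧ R x y (k x y) := by
      intro x y h
      rcases lt_or_gt_of_ne h with h' | h'
      · have := hab x y h
        simp only [k, h', h'.not_gt, if_true, if_false]
        exact ⟨this.1, this.2.1⟩
      · have := hab y x h.symm
        simp only [k, h', h'.not_gt, if_true, if_false]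
        exact ⟨by rw [openCount_comm, ← this.1, add_comm], this.2.2⟩
    obtain ⟨V, hV, hVk⟩ := exists_extension_wonCount hP k fun x y h => (hk x y h).1
    refine ⟨V, hV, fun x => ?_⟩
    by_cases hx : x = c
    · rw [hx]
    have hfx := (hf x hx).1
    refine Finset.le_inf fun z hz => ?_
    have hz : z ≠ c := by simpa using hz
    have h₁ : maximinScore V x ≤ margin V x (f x) := Finset.inf_le (by simp [hfx])
    refine h₁.trans (WithTop.coe_le_coe.2 ?_)
    rw [margin_eq hV _ _ hfx.symm, margin_eq hV _ _ hz.symm, hVk _ _ hfx.symm, hVk _ _ hz.symm,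
      (hk c z hz.symm).2.1 rfl]
    refine ((hk x (f x) hfx.symm).2.2 hx rfl z hz).trans ?_
    rw [lowMargin, highMargin]
    omega

/-- Some margin can make `x` not beat `c` without making the choice of `x` by the other candidate
impossible. -/
def Secure (P : Fin n → PartialVote C) (c x : C) : Prop :=
  ∃ y, y ≠ x ∧ CanLose P c x y ∧ (y ≠ c → ¬CanLose P c y x ∨ CanTie P c x y)

/-- The graph of pairs of candidates of which one or the other can be prevented from beating `c`
by their mutual margin, but not both. -/
def conflictGraph (P : Fin n → PartialVote C) (c : C) : SimpleGraph C where
  Adj x y := x ≠ y ∧ x ≠ c ∧ y ≠ c ∧ CanLose P c x y ∧ CanLose P c y x ∧ ¬CanTie P c x y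
  symm := ⟨fun _ _ h =>
    ⟨h.1.symm, h.2.2.1, h.2.1, h.2.2.2.2.1, h.2.2.2.1, fun h' => h.2.2.2.2.2 h'.symm⟩⟩
  loopless := ⟨fun _ h => h.1 rfl⟩

/-- A rival that does not witness security is a neighbour in the conflict graph, and mutual choice
along an edge is forbidden. Secure candidates need no constraint, so the graph criterion applies
with `c` and the secure candidates exempt. -/
theorem maximin_possible_iff_reachable [Fintype C]
    (hP : ∀ i x y u v, (P i).Und x y → (P i).Und u v → (x = u ∧ y = v) ∨ (x = v ∧ y = u)) (c : C) :
    (∃ V : Fin n → CompleteVote C, (∀ i, (V i).Extends (P i)) ∧ c ∈ maximinWinners V) ↔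
      ∀ x, x ≠ c → ∃ r, (conflictGraph P c).Reachable x r ∧ (Secure P c r ∨
        ∃ b, (conflictGraph P c).Adj r b ∧
          ((conflictGraph P c).deleteEdges {s(r, b)}).Reachable b r) := by
  classical
  rw [maximin_possible_iff hP]
  have hgraph := SimpleGraph.exists_choice_iff (G := conflictGraph P c)
    fun x => x = c ∨ Secure P c x
  -- The vertex `c` is isolated, so exempting it helps no other component.
  have hiso : ∀ {x r}, (conflictGraph P c).Reachable x r → r = c → x = c := by
    rintro x r ⟨p⟩ rfl
    cases p.reverse with
    | nil => rfl
    | cons h _ => exact absurd rfl h.2.1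
  refine Iff.trans ⟨?_, ?_⟩ (hgraph.trans ⟨fun h x hx => ?_, fun h x => ?_⟩)
  · rintro ⟨f, hf⟩
    refine ⟨f, fun x hx => ?_⟩
    push Not at hx
    obtain ⟨hne, hlose, htie⟩ := hf x hx.1
    have hfc : f x ≠ c := fun h => hx.2 ⟨f x, hne, hlose, fun h' => absurd h h'⟩
    have h : ¬(¬CanLose P c (f x) x ∨ CanTie P c x (f x)) := fun h =>
      hx.2 ⟨f x, hne, hlose, fun _ => h⟩
    push Not at h
    exact ⟨⟨hne.symm, hx.1, hfc, hlose, h.1, h.2⟩, fun _ hff => h.2 (htie hfc hff)⟩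
  · rintro ⟨f, hf⟩
    -- Secure candidates take a rival witnessing their security; the others keep `f`. If a secure
    -- candidate and its rival choose each other, the rival can lose to it, so the witness must
    -- provide a tie.
    have : ∀ x, ∃ y, x ≠ c → (Secure P c x → y ≠ x ∧ CanLose P c x y ∧
        (y ≠ c → ¬CanLose P c y x ∨ CanTie P c x y)) ∧ (¬Secure P c x → y = f x) := by
      intro x
      by_cases hs : Secure P c x
      · obtain ⟨y, hy⟩ := id hs
        exact ⟨y, fun _ => ⟨fun _ => hy, fun h => absurd hs h⟩⟩
      · exact ⟨f x, fun _ => ⟨fun h => absurd h hs, fun _ => rfl⟩⟩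
    choose g hg using this
    have hlose : ∀ x, x ≠ c → g x ≠ x ∧ CanLose P c x (g x) := by
      intro x hx
      by_cases hs : Secure P c x
      · exact ⟨((hg x hx).1 hs).1, ((hg x hx).1 hs).2.1⟩
      · have := (hf x (by simp [hx, hs])).1
        rw [(hg x hx).2 hs]
        exact ⟨this.1.symm, this.2.2.2.1⟩
    refine ⟨g, fun x hx => ⟨(hlose x hx).1, (hlose x hx).2, fun hgc hgg => ?_⟩⟩
    have hl := (hlose (g x) hgc).2
    rw [hgg] at hl
    by_cases hs : Secure P c x
    · exact (((hg x hx).1 hs).2.2 hgc).resolve_left (not_not.2 hl)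
    · obtain ⟨hadj, hback⟩ := hf x (by simp [hx, hs])
      rw [← (hg x hx).2 hs] at hadj hback
      by_cases hs' : Secure P c (g x)
      · have := ((hg _ hgc).1 hs').2.2
        rw [hgg] at this
        exact ((this hx).resolve_left (not_not.2 hadj.2.2.2.1)).symm
      · refine absurd ?_ (hback (by simp [hgc, hs']))
        rw [← (hg _ hgc).2 hs', hgg]
  · obtain ⟨r, hr, (rfl | hs) | hc⟩ := h x
    · exact absurd (hiso hr rfl) hx
    · exact ⟨r, hr, Or.inl hs⟩
    · exact ⟨r, hr, Or.inr hc⟩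
  · by_cases hx : x = c
    · exact ⟨x, SimpleGraph.Reachable.refl _, Or.inl (Or.inl hx)⟩
    · obtain ⟨r, hr, hs | hc⟩ := h x hx
      · exact ⟨r, hr, Or.inl (Or.inr hs)⟩
      · exact ⟨r, hr, Or.inr hc⟩

end Profile

/-! ### Breadth first search and decoding of unary prefixes -/

/-- One round of breadth first search in the graph on `0, …, n - 1` with edges `e`. -/
def expand (n : ℕ) (e : ℕ → ℕ → Bool) (l : List Bool) : List Bool :=
  (List.range n).map fun y => l.getD y false || (List.range n).any fun x => l.getD x false && e y x

/-- The indicator list of the vertices reached from the set `s` in the graph on `0, …, n - 1` with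
edges `e`. -/
def reached (n : ℕ) (s : ℕ → Bool) (e : ℕ → ℕ → Bool) : List Bool :=
  iter ((List.range n).map s) (fun _ => expand n e) n

section

variable {α : Type} [Ctx α]

/-- Each round yields an indicator list of length `n a`, so the intermediate values stay bounded. -/
theorem PolyTime.reached {n : α → ℕ} {s : α → ℕ → Bool} {e : α → ℕ → ℕ → Bool} (hn : PolyTime n)
    (hs : PolyTime fun q : α × ℕ => s q.1 q.2)
    (he : PolyTime fun q : (α × ℕ) × ℕ => e q.1.1 q.1.2 q.2) :
    PolyTime fun a => reached (n a) (s a) (e a) := by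
  -- The current list and the round number lie between `a` and the two vertices, so the registers
  -- after those of `a` shift by two.
  have he' : PolyTime fun q : (((α × List Bool) × ℕ) × ℕ) × ℕ => e q.1.1.1.1 q.1.2 q.2 := by
    refine he.rewire (fun q : (((α × List Bool) × ℕ) × ℕ) × ℕ => ((q.1.1.1.1, q.1.2), q.2))
      (fun i => if i < width α then i else i + 2) fun i hi => ?_
    have h₁ : width (α × ℕ) = width α + 1 := rfl
    have h₂ : width ((α × ℕ) × ℕ) = width α + 2 := rfl
    have h₃ : width (α × List Bool) = width α + 1 := rfl
    have h₄ : width ((α × List Bool) × ℕ) = width α + 2 := rfl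
    have h₅ : width (((α × List Bool) × ℕ) × ℕ) = width α + 3 := rfl
    have h₆ : width ((((α × List Bool) × ℕ) × ℕ) × ℕ) = width α + 4 := rfl
    rw [h₂] at hi
    refine ⟨by rw [h₆]; split_ifs <;> omega, fun q => ?_⟩
    simp only [regs, h₁, h₃, h₄, h₅]
    split_ifs <;> first | rfl | omega
  obtain ⟨N, hN⟩ := hn.length_le
  simp only [length_enc_nat] at hN
  refine (PolyTime.iterate (g := fun q : (α × List Bool) × ℕ => expand (n q.1.1) (e q.1.1) q.1.2)
    hn (hn.table hs) ?_ N fun a i _ => ?_).congr fun a => rfl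
  · exact hn.fst.fst.table ((polyTime_snd.fst.fst.getD polyTime_snd).or
      (hn.fst.fst.fst.any ((polyTime_snd.fst.fst.fst.getD polyTime_snd).and he')))
  · refine le_trans (le_of_eq ?_) (hN a)
    cases i <;> simp [iter, expand, enc]

end

/-- The number of leading `true`s. -/
def leadTrues : List Bool → ℕ
  | true :: l => leadTrues l + 1
  | _ => 0

theorem leadTrues_getD (l : List Bool) : (∀ i < leadTrues l, l.getD i false = true) ∧
    l.getD (leadTrues l) false = false := by
  induction l with
  | nil => exact ⟨fun i hi => absurd hi (Nat.not_lt_zero i), rfl⟩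
  | cons b l ih =>
    cases b
    · exact ⟨fun i hi => absurd hi (Nat.not_lt_zero i), rfl⟩
    · refine ⟨fun i hi => ?_, by simpa [leadTrues] using ih.2⟩
      cases i with
      | zero => rfl
      | succ i => simpa using ih.1 i (by simpa [leadTrues] using hi)

theorem leadTrues_le (l : List Bool) : leadTrues l ≤ l.length := by
  by_contra! h
  have := (leadTrues_getD l).1 _ h
  simp at this

theorem PolyTime.leadTrues {α : Type} [Ctx α] {f : α → List Bool} (hf : PolyTime f) :
    PolyTime fun a => leadTrues (f a) := by
  -- The counter is also the reading position and stalls at the first `false`; the default `false`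
  -- stops it at the end of the list.
  have h : ∀ a i, iter 0 (fun _ b => if (f a).getD b false then b + 1 else b) i
      = min i (_root_.leadTrues (f a)) := fun a i => by
    induction i with
    | zero => simp [iter]
    | succ i ih =>
      rw [iter, ih]
      obtain ⟨h₁, h₂⟩ := leadTrues_getD (f a)
      by_cases hi : i < _root_.leadTrues (f a)
      · rw [min_eq_left hi.le, h₁ i hi, if_pos rfl]
        omega
      · rw [min_eq_right (by omega), h₂, if_neg (by simp)]
        omega
  obtain ⟨F, hF⟩ := hf.length_le
  refine (PolyTime.iterate (g := fun q : (α × ℕ) × ℕ =>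
    if (f q.1.1).getD q.1.2 false then q.1.2 + 1 else q.1.2) hf.length (polyTime_const 0)
    ((hf.fst.fst.getD polyTime_snd.fst).ite polyTime_snd.fst.succ polyTime_snd.fst) F
    fun a i hi => ?_).congr fun a => ?_
  · rw [h, length_enc_nat]
    have := hF a
    simp only [enc, id] at this
    omega
  · rw [h, min_eq_right (leadTrues_le _)]

namespace VoteCode

/-! ### The decision procedure -/

/-- The number of candidates. -/
def cands (w : List Bool) : ℕ := leadTrues w

/-- The code without the number of candidates. -/
def rest₁ (w : List Bool) : List Bool := w.drop (cands w + 1)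

/-- The number of voters. -/
def voters (w : List Bool) : ℕ := leadTrues (rest₁ w)

/-- The code without the numbers of candidates and voters. -/
def rest₂ (w : List Bool) : List Bool := (rest₁ w).drop (voters w + 1)

/-- The distinguished candidate. -/
def target (w : List Bool) : ℕ := leadTrues (rest₂ w)

/-- The matrices of the votes. -/
def body (w : List Bool) : List Bool := (rest₂ w).drop (target w + 1)

/-- The matrix entries of the votes. -/
def pref (w : List Bool) (i x y : ℕ) : Bool :=
  (body w).getD (i * (cands w * cands w) + (x * cands w + y)) false

/-- Undetermined pairs. -/
def und (w : List Bool) (i x y : ℕ) : Bool := !pref w i x y && !pref w i y x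

/-- The code has the format of an instance. -/
def wellFormed (w : List Bool) : Bool :=
  -- The strict inequalities say that the terminating `false` of each unary number is present.
  decide (cands w < w.length) && (decide (voters w < (rest₁ w).length) &&
  (decide (target w < (rest₂ w).length) && (decide (target w < cands w) &&
  decide ((body w).length = voters w * (cands w * cands w)))))

/-- All matrices are those of partial orders. -/
def partialOrders (w : List Bool) : Bool :=
  (List.range (voters w)).all fun i => (List.range (cands w)).all fun x => pref w i x x &&
  (List.range (cands w)).all fun y => (!(pref w i x y && pref w i y x) || decide (x = y)) &&
  (List.range (cands w)).all fun z => !(pref w i x y && pref w i y z) || pref w i x z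

/-- All votes have at most one undetermined pair. -/
def almostDetermined (w : List Bool) : Bool :=
  (List.range (voters w)).all fun i => (List.range (cands w)).all fun x =>
  (List.range (cands w)).all fun y => (List.range (cands w)).all fun u =>
  (List.range (cands w)).all fun v => !(und w i x y && und w i u v) ||
    (decide (x = u) && decide (y = v) || decide (x = v) && decide (y = u))

/-- The number of votes that place `x` before `y`. -/
def firm (w : List Bool) (x y : ℕ) : ℕ := (List.range (voters w)).countP fun i => pref w i x y

/-- The number of votes in which the pair of `x` and `y` is undetermined. -/
def opn (w : List Bool) (x y : ℕ) : ℕ := (List.range (voters w)).countP fun i => und w i x y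

/-- The least possible margin of `x` from `y` does not beat the target. -/
def canLose (w : List Bool) (x y : ℕ) : Bool :=
  (List.range (cands w)).all fun z => decide (z = target w) ||
    -- Negative terms of the margins are moved across the inequality to stay within the natural
    -- numbers.
    decide (firm w x y + firm w z (target w) ≤
      firm w y x + opn w x y + (firm w (target w) z + opn w (target w) z))

/-- The margins of `x` and `y` from each other can be such that neither beats the target. -/
def canTie (w : List Bool) (x y : ℕ) : Bool :=
  (List.range (opn w x y + 1)).any fun j => (List.range (cands w)).all fun z =>
    decide (z = target w) ||
    (decide (firm w x y + (j + j) + firm w z (target w) ≤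
      firm w y x + opn w x y + (firm w (target w) z + opn w (target w) z)) &&
    decide (firm w y x + opn w x y + firm w z (target w) ≤
      firm w x y + (j + j) + (firm w (target w) z + opn w (target w) z)))

/-- Some margin can be chosen in favour of the target without excluding another choice. -/
def secure (w : List Bool) (x : ℕ) : Bool :=
  (List.range (cands w)).any fun y => !decide (y = x) && (canLose w x y &&
    (decide (y = target w) || (!canLose w y x || canTie w x y)))

/-- The edges of the conflict graph. -/
def conflict (w : List Bool) (x y : ℕ) : Bool :=
  !decide (x = y) && (!decide (x = target w) && (!decide (y = target w) &&
    (canLose w x y && (canLose w y x && !canTie w x y))))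

/-- The vertices reached from `y` in the conflict graph without the edge between `x` and `y`. -/
def detour (w : List Bool) (x y : ℕ) : List Bool :=
  reached (cands w) (fun u => decide (u = y)) fun u v => conflict w u v &&
    !(decide (u = x) && decide (v = y) || decide (u = y) && decide (v = x))

/-- Security or a cycle through the vertex. -/
def good (w : List Bool) (x : ℕ) : Bool :=
  secure w x || (List.range (cands w)).any fun y => conflict w x y && (detour w x y).getD x false

/-- The answer to the instance. -/
def answer (w : List Bool) : Bool :=
  let l := reached (cands w) (good w) (conflict w)
  (List.range (cands w)).all fun x => decide (x = target w) || l.getD x false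

/-- The decision procedure. -/
def accepts (w : List Bool) : Bool :=
  wellFormed w && (partialOrders w && (almostDetermined w && answer w))

end VoteCode

/-! ### The decision procedure runs in polynomial time -/

section

open VoteCode

variable {α : Type} [Ctx α] {w : α → List Bool}

theorem PolyTime.cands (hw : PolyTime w) : PolyTime fun a => cands (w a) := hw.leadTrues

theorem PolyTime.rest₁ (hw : PolyTime w) : PolyTime fun a => rest₁ (w a) := hw.drop hw.cands.succ

theorem PolyTime.voters (hw : PolyTime w) : PolyTime fun a => voters (w a) := hw.rest₁.leadTrues

theorem PolyTime.rest₂ (hw : PolyTime w) : PolyTime fun a => rest₂ (w a) :=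
  hw.rest₁.drop hw.voters.succ

theorem PolyTime.target (hw : PolyTime w) : PolyTime fun a => target (w a) := hw.rest₂.leadTrues

theorem PolyTime.body (hw : PolyTime w) : PolyTime fun a => body (w a) :=
  hw.rest₂.drop hw.target.succ

variable {i x y : α → ℕ}

theorem PolyTime.pref (hw : PolyTime w) (hi : PolyTime i) (hx : PolyTime x) (hy : PolyTime y) :
    PolyTime fun a => pref (w a) (i a) (x a) (y a) :=
  hw.body.getD ((hi.mul (hw.cands.mul hw.cands)).add ((hx.mul hw.cands).add hy))

theorem PolyTime.und (hw : PolyTime w) (hi : PolyTime i) (hx : PolyTime x) (hy : PolyTime y) :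
    PolyTime fun a => und (w a) (i a) (x a) (y a) :=
  (hw.pref hi hx hy).not.and (hw.pref hi hy hx).not

theorem PolyTime.wellFormed (hw : PolyTime w) : PolyTime fun a => wellFormed (w a) :=
  (hw.cands.lt hw.length).and ((hw.voters.lt hw.rest₁.length).and
    ((hw.target.lt hw.rest₂.length).and ((hw.target.lt hw.cands).and
      (hw.body.length.eq (hw.voters.mul (hw.cands.mul hw.cands))))))

theorem PolyTime.partialOrders (hw : PolyTime w) : PolyTime fun a => partialOrders (w a) := by
  have hi := hw.fst (γ := ℕ)
  have hx := hi.fst (γ := ℕ)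
  have hy := hx.fst (γ := ℕ)
  have hz := hy.fst (γ := ℕ)
  refine hw.voters.all (hi.cands.all ((hx.pref polyTime_snd.fst polyTime_snd polyTime_snd).and
    (hx.cands.all (PolyTime.and ?_ (hy.cands.all ?_)))))
  · exact ((hy.pref polyTime_snd.fst.fst polyTime_snd.fst polyTime_snd).and
      (hy.pref polyTime_snd.fst.fst polyTime_snd polyTime_snd.fst)).not.or
        (polyTime_snd.fst.eq polyTime_snd)
  · exact ((hz.pref polyTime_snd.fst.fst.fst polyTime_snd.fst.fst polyTime_snd.fst).and
      (hz.pref polyTime_snd.fst.fst.fst polyTime_snd.fst polyTime_snd)).not.or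
        (hz.pref polyTime_snd.fst.fst.fst polyTime_snd.fst.fst polyTime_snd)

theorem PolyTime.almostDetermined (hw : PolyTime w) :
    PolyTime fun a => almostDetermined (w a) := by
  have hi := hw.fst (γ := ℕ)
  have hx := hi.fst (γ := ℕ)
  have hy := hx.fst (γ := ℕ)
  have hu := hy.fst (γ := ℕ)
  have hv := hu.fst (γ := ℕ)
  refine hw.voters.all (hi.cands.all (hx.cands.all (hy.cands.all (hu.cands.all
    (PolyTime.or (PolyTime.not (PolyTime.and ?_ ?_)) (PolyTime.or (PolyTime.and ?_ ?_)
      (PolyTime.and ?_ ?_)))))))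
  · exact hv.und polyTime_snd.fst.fst.fst.fst polyTime_snd.fst.fst.fst polyTime_snd.fst.fst
  · exact hv.und polyTime_snd.fst.fst.fst.fst polyTime_snd.fst polyTime_snd
  · exact polyTime_snd.fst.fst.fst.eq polyTime_snd.fst
  · exact polyTime_snd.fst.fst.eq polyTime_snd
  · exact polyTime_snd.fst.fst.fst.eq polyTime_snd
  · exact polyTime_snd.fst.fst.eq polyTime_snd.fst

theorem PolyTime.firm (hw : PolyTime w) (hx : PolyTime x) (hy : PolyTime y) :
    PolyTime fun a => firm (w a) (x a) (y a) :=
  hw.voters.countP (hw.fst.pref polyTime_snd hx.fst hy.fst)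

theorem PolyTime.opn (hw : PolyTime w) (hx : PolyTime x) (hy : PolyTime y) :
    PolyTime fun a => opn (w a) (x a) (y a) :=
  hw.voters.countP (hw.fst.und polyTime_snd hx.fst hy.fst)

theorem PolyTime.canLose (hw : PolyTime w) (hx : PolyTime x) (hy : PolyTime y) :
    PolyTime fun a => canLose (w a) (x a) (y a) := by
  have hw' := hw.fst (γ := ℕ)
  have hx' := hx.fst (γ := ℕ)
  have hy' := hy.fst (γ := ℕ)
  have hz : PolyTime fun q : α × ℕ => q.2 := polyTime_snd
  exact hw.cands.all ((hz.eq hw'.target).or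
    (((hw'.firm hx' hy').add (hw'.firm hz hw'.target)).le
      (((hw'.firm hy' hx').add (hw'.opn hx' hy')).add
        ((hw'.firm hw'.target hz).add (hw'.opn hw'.target hz)))))

theorem PolyTime.canTie (hw : PolyTime w) (hx : PolyTime x) (hy : PolyTime y) :
    PolyTime fun a => canTie (w a) (x a) (y a) := by
  have hw' := (hw.fst (γ := ℕ)).fst (γ := ℕ)
  have hx' := (hx.fst (γ := ℕ)).fst (γ := ℕ)
  have hy' := (hy.fst (γ := ℕ)).fst (γ := ℕ)
  have hj : PolyTime fun q : (α × ℕ) × ℕ => q.1.2 := polyTime_snd.fst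
  have hz : PolyTime fun q : (α × ℕ) × ℕ => q.2 := polyTime_snd
  have hhigh := (hw'.firm hw'.target hz).add (hw'.opn hw'.target hz)
  have hback := (hw'.firm hy' hx').add (hw'.opn hx' hy')
  have hforth := (hw'.firm hx' hy').add (hj.add hj)
  have hfirm := hw'.firm hz hw'.target
  exact (hw.opn hx hy).succ.any (hw.fst.cands.all ((hz.eq hw'.target).or
    (((hforth.add hfirm).le (hback.add hhigh)).and ((hback.add hfirm).le (hforth.add hhigh)))))

theorem PolyTime.secure (hw : PolyTime w) (hx : PolyTime x) :
    PolyTime fun a => secure (w a) (x a) := by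
  have hw' := hw.fst (γ := ℕ)
  have hx' := hx.fst (γ := ℕ)
  have hy : PolyTime fun q : α × ℕ => q.2 := polyTime_snd
  exact hw.cands.any ((hy.eq hx').not.and ((hw'.canLose hx' hy).and
    ((hy.eq hw'.target).or ((hw'.canLose hy hx').not.or (hw'.canTie hx' hy)))))

theorem PolyTime.conflict (hw : PolyTime w) (hx : PolyTime x) (hy : PolyTime y) :
    PolyTime fun a => conflict (w a) (x a) (y a) :=
  (hx.eq hy).not.and ((hx.eq hw.target).not.and ((hy.eq hw.target).not.and
    ((hw.canLose hx hy).and ((hw.canLose hy hx).and (hw.canTie hx hy).not))))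

theorem PolyTime.detour (hw : PolyTime w) (hx : PolyTime x) (hy : PolyTime y) :
    PolyTime fun a => detour (w a) (x a) (y a) := by
  have hx' := (hx.fst (γ := ℕ)).fst (γ := ℕ)
  have hy' := (hy.fst (γ := ℕ)).fst (γ := ℕ)
  have hu : PolyTime fun q : (α × ℕ) × ℕ => q.1.2 := polyTime_snd.fst
  have hv : PolyTime fun q : (α × ℕ) × ℕ => q.2 := polyTime_snd
  exact hw.cands.reached (polyTime_snd.eq hy.fst) ((hw.fst.fst.conflict hu hv).and
    (((hu.eq hx').and (hv.eq hy')).or ((hu.eq hy').and (hv.eq hx'))).not)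

theorem PolyTime.good (hw : PolyTime w) (hx : PolyTime x) :
    PolyTime fun a => good (w a) (x a) :=
  (hw.secure hx).or (hw.cands.any ((hw.fst.conflict hx.fst polyTime_snd).and
    ((hw.fst.detour hx.fst polyTime_snd).getD hx.fst)))

theorem PolyTime.answer (hw : PolyTime w) : PolyTime fun a => answer (w a) := by
  have h : PolyTime fun a => _root_.reached (VoteCode.cands (w a)) (VoteCode.good (w a))
      (VoteCode.conflict (w a)) :=
    hw.cands.reached (hw.fst.good polyTime_snd) (hw.fst.fst.conflict polyTime_snd.fst polyTime_snd)
  exact hw.cands.all ((polyTime_snd.eq hw.fst.target).or (h.fst.getD polyTime_snd))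

theorem VoteCode.polyTime_accepts : PolyTime VoteCode.accepts :=
  have hw : PolyTime fun w : List Bool => w := polyTime_id
  hw.wellFormed.and (hw.partialOrders.and (hw.almostDetermined.and hw.answer))

end

/-- A language decided by register programs in polynomial time is in P. -/
theorem PolyTime.inP {f : List Bool → Bool} (hf : PolyTime f) {L : Language Bool}
    (h : ∀ w, f w = true ↔ w ∈ L) : InP L := by
  obtain ⟨p, P, hP⟩ := hf id 1 fun i hi => hi
  -- The program preserves its input, whereas the machine must halt with nothing but the output on
  -- its stacks.
  refine ⟨f, h, Prog.nonempty_computableInPolyTime (.seq p (.clear 0))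
    (P + (2 * Polynomial.X + 1)) f fun w => ?_⟩
  have hsize : size w = w.length := by
    rw [size]
    exact Finset.sum_range_one _
  have h₁ := hP w (update (fun _ => []) 0 w) (fun i hi => by
    have hi : i = 0 := Nat.lt_one_iff.1 hi
    subst hi
    rfl) fun i hi => by simp [show i ≠ 0 by omega]
  refine (h₁.seq (Prog.runs_clear 0 _)).congr ?_ ?_
  · funext i
    by_cases hi : i = 0
    · subst hi; simp
    · by_cases hi₁ : i = 1
      · subst hi₁; simp [enc]
      · simp [hi, hi₁]
  · simp [hsize]

/-! ### Correctness of the decision procedure -/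

theorem Bool.not_or_eq_true_iff {a b : Bool} : (!a || b) = true ↔ (a = true → b = true) := by
  cases a <;> simp

theorem List.all_range_iff {n : ℕ} {f : ℕ → Bool} :
    (List.range n).all f = true ↔ ∀ i : Fin n, f i = true := by
  rw [List.all_eq_true]
  exact ⟨fun h i => h i (List.mem_range.2 i.2), fun h i hi => h ⟨i, List.mem_range.1 hi⟩⟩

theorem List.any_range_iff {n : ℕ} {f : ℕ → Bool} :
    (List.range n).any f = true ↔ ∃ i : Fin n, f i = true := by
  rw [List.any_eq_true]
  exact ⟨fun ⟨i, hi, h⟩ => ⟨⟨i, List.mem_range.1 hi⟩, h⟩, fun ⟨i, h⟩ => ⟨i, List.mem_range.2 i.2, h⟩⟩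

theorem List.countP_range (n : ℕ) (f : ℕ → Bool) :
    (List.range n).countP f = (Finset.univ.filter fun i : Fin n => f i = true).card := by
  induction n generalizing f with
  | zero => rfl
  | succ n ih =>
    rw [List.range_succ_eq_map, List.countP_cons, List.countP_map, Fin.card_filter_univ_succ, ih]
    cases h : f 0 <;> simp [h]

theorem List.getD_map_range {n : ℕ} (f : ℕ → Bool) (i : Fin n) :
    ((List.range n).map f).getD i false = f i := by
  simp [List.getD_eq_getElem?_getD]

/-- After `k` rounds the list marks the ends of walks of length at most `k` from `s`. Paths have
fewer than `n` edges, so `n` rounds suffice. -/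
theorem getD_reached {n : ℕ} (G : SimpleGraph (Fin n)) {s : ℕ → Bool} {e : ℕ → ℕ → Bool}
    (he : ∀ x y : Fin n, e x y = true ↔ G.Adj x y) (y : Fin n) :
    (reached n s e).getD y false = true ↔ ∃ x : Fin n, s x = true ∧ G.Reachable x y := by
  have h : ∀ k (y : Fin n),
      (iter ((List.range n).map s) (fun _ => expand n e) k).getD y false = true ↔
        ∃ x : Fin n, s x = true ∧ ∃ p : G.Walk x y, p.length ≤ k := by
    intro k
    induction k with
    | zero =>
      intro y
      rw [iter, List.getD_map_range]
      constructor
      · exact fun h => ⟨y, h, .nil, le_rfl⟩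
      · rintro ⟨x, hx, p, hp⟩
        rwa [← p.eq_of_length_eq_zero (by omega)]
    | succ k ih =>
      intro y
      rw [iter, expand, List.getD_map_range, Bool.or_eq_true, List.any_range_iff, ih]
      simp only [Bool.and_eq_true, ih, he]
      constructor
      · rintro (⟨x, hx, p, hp⟩ | ⟨u, ⟨x, hx, p, hp⟩, hyu⟩)
        · exact ⟨x, hx, p, by omega⟩
        · exact ⟨x, hx, p.concat hyu.symm, by simpa using hp⟩
      · rintro ⟨x, hx, p, hp⟩
        -- Reversal exposes the last edge of the walk, which is the one added in the final round.
        rw [← p.length_reverse] at hp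
        cases hr : p.reverse with
        | nil => exact Or.inl ⟨_, hx, .nil, Nat.zero_le _⟩
        | cons hyu q =>
          rw [hr, SimpleGraph.Walk.length_cons] at hp
          exact Or.inr ⟨_, ⟨x, hx, q.reverse, by simpa using hp⟩, hyu⟩
  rw [reached, h]
  constructor
  · rintro ⟨x, hx, p, _⟩
    exact ⟨x, hx, ⟨p⟩⟩
  · rintro ⟨x, hx, hr⟩
    obtain ⟨p, hp⟩ := hr.exists_isPath
    exact ⟨x, hx, p, by simpa using hp.length_lt.le⟩

theorem leadTrues_unaryBits_append (k : ℕ) (l : List Bool) :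
    leadTrues (unaryBits k ++ l) = k := by
  induction k with
  | zero => rfl
  | succ k ih => simpa [unaryBits, List.replicate_succ, leadTrues] using ih

theorem drop_unaryBits_append (k : ℕ) (l : List Bool) : (unaryBits k ++ l).drop (k + 1) = l :=
  List.drop_left' (by simp [unaryBits])

theorem length_unaryBits (k : ℕ) : (unaryBits k).length = k + 1 := by
  simp [unaryBits]

theorem unaryBits_leadTrues_append {l : List Bool} (h : leadTrues l < l.length) :
    unaryBits (leadTrues l) ++ l.drop (leadTrues l + 1) = l := by
  induction l with
  | nil => exact absurd h (Nat.not_lt_zero _)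
  | cons b l ih =>
    cases b
    · rfl
    · simpa [leadTrues, unaryBits, List.replicate_succ] using ih (by simpa [leadTrues] using h)

theorem getD_flatten_ofFn {n m : ℕ} {f : Fin n → List Bool} (hf : ∀ i, (f i).length = m)
    (i : Fin n) {j : ℕ} (hj : j < m) :
    (List.ofFn f).flatten.getD (i * m + j) false = (f i).getD j false := by
  induction n with
  | zero => exact i.elim0
  | succ n ih =>
    rw [List.ofFn_succ, List.flatten_cons]
    refine Fin.cases ?_ (fun i => ?_) i
    · rw [List.getD_append _ _ _ _ (by simpa [hf] using hj)]
      simp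
    · rw [List.getD_append_right _ _ _ _ (by simp [hf, Nat.succ_mul]; omega), hf]
      have : ((i.succ : Fin (n + 1)) : ℕ) * m + j - m = i * m + j := by
        simp [Nat.succ_mul]
        omega
      rw [this]
      exact ih (fun i => hf i.succ) i

theorem ofFn_flatten_getD {n m : ℕ} {l : List Bool} (h : l.length = n * m) :
    (List.ofFn fun i : Fin n => List.ofFn fun j : Fin m =>
      l.getD (i * m + j) false).flatten = l := by
  have := List.ofFn_mul (m := n) (n := m) fun k : Fin (n * m) => l.getD k false
  rw [← this]
  refine List.ext_getElem (by simp [h]) fun i h₁ h₂ => ?_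
  rw [List.getElem_ofFn, List.getD_eq_getElem _ _ h₂]

/-! ### Strings that encode instances, and the procedure on them -/

namespace VoteCode

theorem pref_eq_of_eq {w : List Bool} {m n : ℕ} (hm : cands w = m) {P : Fin n → PartialVote (Fin m)}
    (hb : body w = (List.ofFn fun i => (P i).bits).flatten) (i : Fin n) (x y : Fin m) :
    pref w i x y = (P i).pref x y := by
  have hlt : (x : ℕ) * m + y < m * m := by
    have h₁ := Nat.mul_le_mul_right m (Nat.succ_le_of_lt x.2)
    rw [Nat.succ_mul] at h₁
    omega
  rw [pref, hb, hm, getD_flatten_ofFn (fun i => (P i).length_bits) i hlt, PartialVote.bits,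
    getD_flatten_ofFn (m := m) (by simp) x y.2]
  simp [List.getD_eq_getElem?_getD]

section Encode

variable (I : PossibleWinnerInstance)

theorem encode_eq : I.encode = unaryBits I.numCandidates ++ (unaryBits I.numVoters ++
    (unaryBits I.candidate ++ (List.ofFn fun i => (I.votes i).bits).flatten)) := by
  simp [PossibleWinnerInstance.encode]

theorem cands_encode : cands I.encode = I.numCandidates := by
  rw [cands, encode_eq, leadTrues_unaryBits_append]

theorem rest₁_encode : rest₁ I.encode = unaryBits I.numVoters ++
    (unaryBits I.candidate ++ (List.ofFn fun i => (I.votes i).bits).flatten) := by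
  rw [rest₁, cands_encode, encode_eq, drop_unaryBits_append]

theorem voters_encode : voters I.encode = I.numVoters := by
  rw [voters, rest₁_encode, leadTrues_unaryBits_append]

theorem rest₂_encode : rest₂ I.encode =
    unaryBits I.candidate ++ (List.ofFn fun i => (I.votes i).bits).flatten := by
  rw [rest₂, voters_encode, rest₁_encode, drop_unaryBits_append]

theorem target_encode : target I.encode = I.candidate := by
  rw [target, rest₂_encode, leadTrues_unaryBits_append]

theorem body_encode : body I.encode = (List.ofFn fun i => (I.votes i).bits).flatten := by
  rw [body, target_encode, rest₂_encode, drop_unaryBits_append]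

theorem wellFormed_encode : wellFormed I.encode = true := by
  simp only [wellFormed, Bool.and_eq_true, decide_eq_true_eq, cands_encode, voters_encode,
    target_encode, body_encode, rest₁_encode, rest₂_encode]
  refine ⟨?_, ?_, ?_, I.candidate.2, ?_⟩
  · rw [encode_eq, List.length_append, length_unaryBits]
    omega
  · rw [List.length_append, length_unaryBits]
    omega
  · rw [List.length_append, length_unaryBits]
    omega
  · simp [List.length_flatten, Function.comp_def, PartialVote.length_bits]

end Encode

variable {w : List Bool} {m n : ℕ} {c : Fin m} {P : Fin n → PartialVote (Fin m)}

/-- The string `w` describes the given profile of partial votes and the given candidate. -/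
structure Describes (w : List Bool) {m n : ℕ} (c : Fin m) (P : Fin n → PartialVote (Fin m)) :
    Prop where
  cands : cands w = m
  voters : voters w = n
  target : target w = c
  pref : ∀ (i : Fin n) (x y : Fin m), pref w i x y = (P i).pref x y

theorem describes_encode (I : PossibleWinnerInstance) :
    Describes I.encode I.candidate I.votes :=
  ⟨cands_encode I, voters_encode I, target_encode I,
    pref_eq_of_eq (cands_encode I) (body_encode I)⟩

theorem partialOrders_iff : partialOrders w = true ↔ ∀ (i : Fin (voters w)) (x : Fin (cands w)),
    pref w i x x = true ∧ ∀ y : Fin (cands w),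
      (pref w i x y = true → pref w i y x = true → x = y) ∧ ∀ z : Fin (cands w),
        pref w i x y = true → pref w i y z = true → pref w i x z = true := by
  simp only [partialOrders, List.all_range_iff, Bool.and_eq_true,
    Bool.not_or_eq_true_iff, decide_eq_true_eq, Fin.ext_iff, and_imp]

/-- The format and order axioms tested are all that an encoding requires. Hence every accepted
string is an encoding, and correctness need only be examined on encodings. -/
theorem exists_encode_eq (hw : wellFormed w = true) (hp : partialOrders w = true) :
    ∃ I : PossibleWinnerInstance, I.encode = w := by
  simp only [wellFormed, Bool.and_eq_true, decide_eq_true_eq] at hw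
  obtain ⟨h₁, h₂, h₃, h₄, h₅⟩ := hw
  rw [partialOrders_iff] at hp
  refine ⟨⟨cands w, voters w, ⟨target w, h₄⟩, fun i =>
    { pref := fun x y => pref w i x y
      refl := fun x => (hp i x).1
      antisymm := fun x y => ((hp i x).2 y).1
      trans := fun x y z => ((hp i x).2 y).2 z }⟩, ?_⟩
  have hb : (List.ofFn fun i : Fin (voters w) => (List.ofFn fun x : Fin (cands w) =>
      List.ofFn fun y : Fin (cands w) => pref w i x y).flatten).flatten = body w := by
    refine Eq.trans ?_ (ofFn_flatten_getD h₅)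
    congr 2
    funext i
    have := List.ofFn_mul (m := cands w) (n := cands w)
      fun k : Fin (cands w * cands w) => (body w).getD (i * (cands w * cands w) + k) false
    exact this.symm
  rw [encode_eq]
  simp only [PartialVote.bits]
  rw [hb]
  have e₃ : unaryBits (target w) ++ body w = rest₂ w := unaryBits_leadTrues_append h₃
  have e₂ : unaryBits (voters w) ++ rest₂ w = rest₁ w := unaryBits_leadTrues_append h₂
  have e₁ : unaryBits (cands w) ++ rest₁ w = w := unaryBits_leadTrues_append h₁
  rw [e₃, e₂, e₁]

namespace Describes

theorem partialOrders (h : Describes w c P) : VoteCode.partialOrders w = true := by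
  rw [partialOrders_iff]
  obtain ⟨rfl, rfl, -, hp⟩ := h
  simp only [hp]
  exact fun i x => ⟨(P i).refl x, fun y => ⟨(P i).antisymm x y, fun z => (P i).trans x y z⟩⟩

theorem und (h : Describes w c P) (i : Fin n) (x y : Fin m) :
    VoteCode.und w i x y = true ↔ (P i).Und x y := by
  simp [VoteCode.und, PartialVote.Und, h.pref]

theorem almostDetermined (h : Describes w c P) : VoteCode.almostDetermined w = true ↔
    ∀ i x y u v, (P i).Und x y → (P i).Und u v → (x = u ∧ y = v) ∨ (x = v ∧ y = u) := by
  simp only [VoteCode.almostDetermined, h.cands, h.voters, List.all_range_iff,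
    Bool.not_or_eq_true_iff]
  simp only [Bool.or_eq_true, Bool.and_eq_true, decide_eq_true_eq, ← Fin.ext_iff, h.und, and_imp]

theorem firm (h : Describes w c P) (x y : Fin m) : VoteCode.firm w x y = firmCount P x y := by
  rw [VoteCode.firm, h.voters, List.countP_range, firmCount]
  simp only [h.pref]

theorem opn (h : Describes w c P) (x y : Fin m) : VoteCode.opn w x y = openCount P x y := by
  rw [VoteCode.opn, h.voters, List.countP_range, openCount]
  simp only [h.und]

theorem canLose (h : Describes w c P) (x y : Fin m) :
    VoteCode.canLose w x y = true ↔ CanLose P c x y := by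
  simp only [VoteCode.canLose, h.cands, h.target, List.all_range_iff, Bool.or_eq_true,
    decide_eq_true_eq, h.firm, h.opn, ← Fin.ext_iff, CanLose, lowMargin, highMargin]
  refine forall_congr' fun z => ?_
  rw [or_iff_not_imp_left]
  refine imp_congr Iff.rfl ?_
  omega

theorem canTie (h : Describes w c P) (x y : Fin m) :
    VoteCode.canTie w x y = true ↔ CanTie P c x y := by
  simp only [VoteCode.canTie, h.cands, h.target, List.all_range_iff, List.any_eq_true,
    List.mem_range, Bool.or_eq_true, Bool.and_eq_true, Nat.lt_succ_iff,
    decide_eq_true_eq, h.firm, h.opn, ← Fin.ext_iff, CanTie, lowMargin, highMargin]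
  refine exists_congr fun j => and_congr Iff.rfl (forall_congr' fun z => ?_)
  rw [or_iff_not_imp_left]
  refine imp_congr Iff.rfl ?_
  omega

theorem secure (h : Describes w c P) (x : Fin m) :
    VoteCode.secure w x = true ↔ Secure P c x := by
  simp only [VoteCode.secure, h.cands, h.target, List.any_range_iff, Bool.or_eq_true,
    Bool.and_eq_true, Bool.not_eq_true', decide_eq_true_eq,
    ← Fin.ext_iff, Secure, h.canTie, h.canLose, ← Bool.not_eq_true]
  refine exists_congr fun y => and_congr Iff.rfl (and_congr Iff.rfl ?_)
  exact or_iff_not_imp_left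

theorem conflict (h : Describes w c P) (x y : Fin m) :
    VoteCode.conflict w x y = true ↔ (conflictGraph P c).Adj x y := by
  simp only [VoteCode.conflict, h.target, Bool.and_eq_true, Bool.not_eq_true',
    decide_eq_true_eq, ← Fin.ext_iff, h.canTie, h.canLose,
    ← Bool.not_eq_true, conflictGraph, ne_eq]

theorem detour (h : Describes w c P) (x y z : Fin m) :
    (VoteCode.detour w x y).getD z false = true ↔
      ((conflictGraph P c).deleteEdges {s(x, y)}).Reachable y z := by
  rw [VoteCode.detour, h.cands, getD_reached ((conflictGraph P c).deleteEdges {s(x, y)})]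
  · simp [← Fin.ext_iff]
  · intro u v
    rw [SimpleGraph.deleteEdges_adj, Bool.and_eq_true, h.conflict]
    simp [← Fin.ext_iff, ← Bool.not_eq_true, imp_iff_not_or]

theorem good (h : Describes w c P) (x : Fin m) : VoteCode.good w x = true ↔
    Secure P c x ∨ ∃ y, (conflictGraph P c).Adj x y ∧
      ((conflictGraph P c).deleteEdges {s(x, y)}).Reachable y x := by
  simp only [VoteCode.good, Bool.or_eq_true, h.cands, List.any_range_iff, Bool.and_eq_true,
    h.secure, h.conflict, h.detour]

theorem answer (h : Describes w c P)
    (hP : ∀ i x y u v, (P i).Und x y → (P i).Und u v → (x = u ∧ y = v) ∨ (x = v ∧ y = u)) :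
    VoteCode.answer w = true ↔ ∃ V : Fin n → CompleteVote (Fin m),
      (∀ i, (V i).Extends (P i)) ∧ c ∈ maximinWinners V := by
  rw [maximin_possible_iff_reachable hP]
  simp only [VoteCode.answer, h.cands, h.target, List.all_range_iff, Bool.or_eq_true,
    decide_eq_true_eq, ← Fin.ext_iff, getD_reached (conflictGraph P c) h.conflict, h.good]
  refine forall_congr' fun x => ?_
  rw [or_iff_not_imp_left]
  refine imp_congr Iff.rfl (exists_congr fun r => ?_)
  -- The search runs from the good vertices to `x`, the criterion from `x` to a good vertex.
  rw [and_comm, SimpleGraph.reachable_comm]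

end Describes

theorem accepts_encode (I : PossibleWinnerInstance) :
    accepts I.encode = true ↔ I.UndeterminedAtMost 1 ∧ I.IsMaximinYes := by
  have h := describes_encode I
  have hu : I.UndeterminedAtMost 1 ↔ ∀ i x y u v, (I.votes i).Und x y → (I.votes i).Und u v →
      (x = u ∧ y = v) ∨ (x = v ∧ y = u) :=
    forall_congr' fun i => PartialVote.card_undeterminedPairs_le_one
  rw [accepts, wellFormed_encode, h.partialOrders, Bool.true_and, Bool.true_and, Bool.and_eq_true,
    h.almostDetermined, ← hu]
  -- The search is known to be correct only when votes have at most one undetermined pair, so that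
  -- conjunct is assumed first.
  exact and_congr_right fun h' => h.answer (hu.1 h')

theorem accepts_iff (w : List Bool) : accepts w = true ↔ w ∈ maximinPossibleWinner 1 := by
  constructor
  · intro h
    have h' := h
    rw [accepts, Bool.and_eq_true, Bool.and_eq_true] at h'
    obtain ⟨I, rfl⟩ := exists_encode_eq h'.1 h'.2.1
    exact ⟨I, rfl, (accepts_encode I).1 h⟩
  · rintro ⟨I, rfl, h⟩
    exact (accepts_encode I).2 h

end VoteCode

theorem mainTheorem9 : InP (maximinPossibleWinner 1) := by
  exact VoteCode.polyTime_accepts.inP VoteCode.accepts_iff
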